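/- A tournament is a pair $T=(V,E)$ where $V$ is a (finite or infinite) set of vertices and $E\subseteq V\times V$ is an irreflexive, antisymmetric and complete relation; it is acyclic if it contains no $3$-element cycle. A set $A\subseteq V$ is autonomous if for all $x,x'\in A$ and $y\in V\setminus A$ one has $(x,y)\in E\iff (x',y)\in E$. The acyclic component of $x \in V$ is the union of all autonomous sets $A\ni x$ on which $T$ induces an acyclic tournament. The lexicographical sum of tournaments $T_i$ indexed by a tournament $D$ is the tournament on the disjoint union of the vertex sets of the $T_i$ in which there is an edge from $x\in V(T_i)$ to $y\in V(T_j)$ if either $i=j$ and $(x,y)\in E(T_i)$, or $(i,j)\in E(D)$. The profile of $T$ is the function $\varphi_T$ such that, for each integer $n \ge 0$, $\varphi_T(n)$ is the number of tournaments induced by $T$ on the $n$-element subsets of $V$, isomorphic tournaments being identified. Theorem. Let $T$ be a tournament which is (isomorphic to) a lexicographical sum of acyclic tournaments indexed by a finite tournament. Then the number $k$ of infinite acyclic components of $T$ is finite, the generating series of the profile is a rational fraction of the form $$\sum_{n=0}^{\infty}\varphi_T(n)x^n=\frac{P(x)}{(1-x)(1-x^2)\cdots(1-x^k)}$$ with $P(x)\in\mathbb{Z}[x]$,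 and $\varphi_T(n)\simeq a\,n^{k-1}$ as $n\to\infty$ for some non-negative real $a$, which is positive if $k\ge 1$. Here $\simeq$ is asymptotic equivalence: $f\simeq g$ means $f-g=o(g)$ (the quotient tends to $1$ where $g$ does not vanish; for $g=0$ it means that $f(n)=0$ for all large $n$, which occurs for $k=0$, that is, for $T$ finite). -/

import Mathlib

/-- A tournament on the vertex set `V` (finite or infinite): a binary relation `Adj`
(`Adj x y` says that `(x, y)` is an edge) that is irreflexive, antisymmetric and complete. -/
structure Tournament (V : Type*) extends Digraph V where
  irrefl : ∀ x, ¬ Adj x x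
  antisymm : ∀ x y, Adj x y → Adj y x → x = y
  complete : ∀ x y, x ≠ y → Adj x y ∨ Adj y x

namespace Tournament

/-- Isomorphisms of tournaments: bijections that preserve and reflect edges. -/
abbrev Iso {V W : Type*} (T : Tournament V) (S : Tournament W) : Type _ :=
  T.Adj ≃r S.Adj

/-- The restriction of `T` to a set `A` of vertices. -/
def induce {V : Type*} (T : Tournament V) (A : Set V) : Tournament A where
  Adj x y := T.Adj x y
  irrefl x := T.irrefl x
  antisymm x y h h' := Subtype.ext (T.antisymm x y h h')
  complete x y h := T.complete x y (fun e => h (Subtype.ext e))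

/-- A tournament is acyclic if it contains no `3`-element cycle. -/
def IsAcyclic {V : Type*} (T : Tournament V) : Prop :=
  ∀ a b c : V, ¬ (T.Adj a b ∧ T.Adj b c ∧ T.Adj c a)

/-- The lexicographical sum of the tournaments `S i` indexed by the tournament `D`: its vertex
set is the disjoint union of the vertex sets of the `S i`, and there is an edge from `(i, x)` to
`(j, y)` if `(i, j)` is an edge of `D`, or if `i = j` and `(x, y)` is an edge of `S i`. -/
def lexSum {I : Type*} {W : I → Type*} (D : Tournament I) (S : ∀ i, Tournament (W i)) :
    Tournament (Σ i, W i) where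
  Adj := Sigma.Lex D.Adj (fun i => (S i).Adj)
  irrefl := by
    rintro ⟨i, x⟩ h
    cases h with
    | left _ _ h => exact D.irrefl i h
    | right _ _ h => exact (S i).irrefl x h
  antisymm := by
    rintro ⟨i, x⟩ ⟨j, y⟩ h h'
    cases h with
    | left _ _ h =>
      cases h' with
      | left _ _ h' =>
        obtain rfl := D.antisymm i j h h'
        exact absurd h (D.irrefl i)
      | right _ _ h' => exact absurd h (D.irrefl i)
    | right _ _ h =>
      cases h' with
      | left _ _ h' => exact absurd h' (D.irrefl i)
      | right _ _ h' => exact congrArg (Sigma.mk i) ((S i).antisymm _ _ h h')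
  complete := by
    rintro ⟨i, x⟩ ⟨j, y⟩ h
    by_cases hij : i = j
    · subst hij
      have hxy : x ≠ y := fun e => h (by rw [e])
      exact ((S i).complete x y hxy).imp (Sigma.Lex.right x y) (Sigma.Lex.right y x)
    · exact (D.complete i j hij).imp (Sigma.Lex.left x y) (Sigma.Lex.left y x)

/-- A set `A` of vertices is autonomous if every vertex outside `A` is related in the same way
to all elements of `A`. -/
def IsAutonomous {V : Type*} (T : Tournament V) (A : Set V) : Prop :=
  ∀ x ∈ A, ∀ x' ∈ A, ∀ y ∉ A, (T.Adj x y ↔ T.Adj x' y)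

/-- The union of all acyclic autonomous sets of vertices that contain `x`. -/
def acyclicComponent {V : Type*} (T : Tournament V) (x : V) : Set V :=
  ⋃₀ {A : Set V | T.IsAutonomous A ∧ (T.induce A).IsAcyclic ∧ x ∈ A}

/-- The set of acyclic components of `T`. -/
def acyclicComponents {V : Type*} (T : Tournament V) : Set (Set V) :=
  Set.range T.acyclicComponent

/-- Two `n`-element sets of vertices are identified when they induce isomorphic tournaments. -/
def isoSetoid {V : Type*} (T : Tournament V) (n : ℕ) :
    Setoid {A : Finset V // A.card = n} where
  r A B := Nonempty (Iso (T.induce (A.1 : Set V)) (T.induce (B.1 : Set V)))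
  iseqv :=
    { refl := fun _ => ⟨RelIso.refl _⟩
      symm := fun ⟨e⟩ => ⟨e.symm⟩
      trans := fun ⟨e⟩ ⟨f⟩ => ⟨e.trans f⟩ }

/-- The profile of `T`: the number of tournaments induced by `T` on the `n`-element sets of
vertices, isomorphic tournaments being identified. -/
noncomputable def profile {V : Type*} (T : Tournament V) (n : ℕ) : ℕ :=
  Nat.card (Quotient (T.isoSetoid n))

/-- The generating series of the profile. -/
noncomputable def profileSeries {V : Type*} (T : Tournament V) : PowerSeries ℤ :=
  PowerSeries.mk fun n => (T.profile n : ℤ)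

end Tournament

/-!
A tournament is the lexicographical sum of its acyclic components, indexed by a tournament whose
acyclic components are singletons (a reduced one). Hence a finite tournament induced by `T` is
given by a reduced tournament `D` on at most as many vertices as `T` has acyclic components and by
the vector `l` of the lengths of the chains replacing the vertices of `D`; this pair is unique up to
relabelling, so the profile counts orbits of pairs `(D, l)` under permutations.

For fixed `D` the vectors `l` that occur form a lower set. Splitting such a set along a coordinate
hyperplane, by induction on lower sets of `ℕ ^ r` (a well-founded order, by Dickson's lemma), shows
that its weighted counting series is a fraction with denominator `(1 - x) ⋯ (1 - x ^ k)` as soon as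
no set of coordinates that are simultaneously unbounded on it has total weight more than `k`. By
Burnside's lemma the orbit count is an average of such series, one for each permutation and each
`D` it fixes, the weights being the lengths of the cycles. The chains of unbounded length sit in
distinct infinite components of `T`, so `k` can be taken to be the number of these. Conversely,
chains of arbitrary lengths embed into the infinite components, so the profile grows at least like
`n ^ (k - 1)`, and the limit of `φ n / n ^ (k - 1)`, which exists because of the denominator, is
positive.
-/

open Filter Topology Asymptotics Finset
open scoped PowerSeries Polynomial

section FractionSeries

variable {R : Type*} [CommRing R]

/-- The power series that are rational fractions with denominator `q`, encoded as those whose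
product with `q` is a polynomial. -/
noncomputable def fractionSeries (q : R[X]) : Submodule R[X] R⟦X⟧ :=
  (LinearMap.range (Algebra.linearMap R[X] R⟦X⟧)).comap (LinearMap.lsmul R[X] R⟦X⟧ q)

theorem polynomial_smul_eq_coe_mul (q : R[X]) (F : R⟦X⟧) : q • F = q * F := by
  rw [Algebra.smul_def, PowerSeries.algebraMap_apply']; simp

theorem mem_fractionSeries {q : R[X]} {F : R⟦X⟧} :
    F ∈ fractionSeries q ↔ ∃ P : R[X], (P : R⟦X⟧) = q * F := by
  simp [fractionSeries, PowerSeries.algebraMap_apply', Algebra.smul_def,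
    ← Polynomial.polynomial_map_coe]

theorem mem_fractionSeries_iff_eventually {q : R[X]} {F : R⟦X⟧} :
    F ∈ fractionSeries q ↔ ∀ᶠ n in atTop, PowerSeries.coeff n (q * F : R⟦X⟧) = 0 := by
  rw [mem_fractionSeries]
  constructor
  · rintro ⟨P, hP⟩
    filter_upwards [eventually_gt_atTop P.natDegree] with n hn
    rw [← hP, Polynomial.coeff_coe, Polynomial.coeff_eq_zero_of_natDegree_lt hn]
  · intro h
    obtain ⟨N, hN⟩ := eventually_atTop.1 h
    refine ⟨PowerSeries.trunc N (q * F), PowerSeries.ext fun n => ?_⟩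
    rw [Polynomial.coeff_coe, PowerSeries.coeff_trunc]
    split_ifs with hn
    · rfl
    · exact (hN n (not_lt.1 hn)).symm

theorem smul_mem_fractionSeries {p q : R[X]} {F : R⟦X⟧} :
    p • F ∈ fractionSeries q ↔ F ∈ fractionSeries (q * p) := by
  simp only [fractionSeries, Submodule.mem_comap, LinearMap.lsmul_apply, mul_smul]

theorem fractionSeries_mono {p q : R[X]} (h : p ∣ q) : fractionSeries p ≤ fractionSeries q := by
  obtain ⟨r, rfl⟩ := h
  exact fun F hF => smul_mem_fractionSeries.1 (Submodule.smul_mem _ r hF)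

theorem mem_fractionSeries_of_nsmul [NoZeroDivisors R] [CharZero R] {q : R[X]} {F : R⟦X⟧}
    {m : ℕ} (hm : m ≠ 0) (h : m • F ∈ fractionSeries q) : F ∈ fractionSeries q := by
  rw [mem_fractionSeries_iff_eventually] at h ⊢
  filter_upwards [h] with n hn
  rw [mul_smul_comm, map_nsmul, nsmul_eq_mul] at hn
  exact (mul_eq_zero_iff_left (Nat.cast_ne_zero.2 hm)).1 hn

theorem map_mem_fractionSeries {S : Type*} [CommRing S] (φ : R →+* S) {q : R[X]} {F : R⟦X⟧}
    (h : F ∈ fractionSeries q) : F.map φ ∈ fractionSeries (q.map φ) := by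
  obtain ⟨P, hP⟩ := mem_fractionSeries.1 h
  refine mem_fractionSeries.2 ⟨P.map φ, ?_⟩
  rw [Polynomial.polynomial_map_coe, Polynomial.polynomial_map_coe, hP, map_mul]

variable (R) in
/-- The `q`-Pochhammer polynomial `(1 - X) (1 - X ^ 2) ⋯ (1 - X ^ k)`. -/
noncomputable def qPochhammer (k : ℕ) : R[X] :=
  ∏ i ∈ Icc 1 k, (1 - Polynomial.X ^ i)

theorem qPochhammer_succ (k : ℕ) :
    qPochhammer R (k + 1) = qPochhammer R k * (1 - Polynomial.X ^ (k + 1)) :=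
  prod_Icc_succ_top (Nat.le_add_left 1 k) _

theorem coe_qPochhammer (k : ℕ) :
    (qPochhammer R k : R⟦X⟧) = ∏ i ∈ Icc 1 k, (1 - PowerSeries.X ^ i) := by
  rw [qPochhammer, ← Polynomial.coeToPowerSeries.ringHom_apply, map_prod]
  simp

theorem map_qPochhammer {S : Type*} [CommRing S] (φ : R →+* S) (k : ℕ) :
    (qPochhammer R k).map φ = qPochhammer S k := by
  simp [qPochhammer, Polynomial.map_prod]

/-- Among `w` consecutive exponents there is a multiple of `w`. -/
theorem qPochhammer_mul_dvd {w : ℕ} (hw : 0 < w) (k : ℕ) :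
    qPochhammer R k * (1 - Polynomial.X ^ w) ∣ qPochhammer R (k + w) := by
  obtain ⟨m, hkm, hmk⟩ : ∃ m, k < w * m ∧ w * m ≤ k + w :=
    ⟨k / w + 1, Nat.lt_mul_div_succ k hw,
      by rw [mul_add, mul_one]; exact Nat.add_le_add_right (Nat.mul_div_le k w) w⟩
  have hdvd : (1 - Polynomial.X ^ w : R[X]) ∣ 1 - Polynomial.X ^ (w * m) := by
    simpa [pow_mul] using sub_dvd_pow_sub_pow (1 : R[X]) (Polynomial.X ^ w) m
  have hsub : insert (w * m) (Icc 1 k) ⊆ Icc 1 (k + w) := by grind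
  refine dvd_trans ?_ (prod_dvd_prod_of_subset _ _ _ hsub)
  rw [prod_insert (by simp [hkm]), mul_comm]
  exact mul_dvd_mul_right hdvd _

end FractionSeries

section Asymptotics

theorem tendsto_pow_sub_pow_div (c d : ℕ) :
    Tendsto (fun n : ℕ => ((n : ℝ) ^ (d + 1) - ((n : ℝ) - c) ^ (d + 1)) / (n : ℝ) ^ d) atTop
      (𝓝 (c * (d + 1))) := by
  have hderiv : HasDerivAt (fun t : ℝ => -(1 - c * t) ^ (d + 1)) (c * (d + 1)) 0 := by
    have := (((hasDerivAt_id (0 : ℝ)).const_mul (c : ℝ)).const_sub 1).pow (d + 1)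
    refine this.neg.congr_deriv ?_
    simp [mul_comm]
  have hslope := hderiv.tendsto_slope_zero_right.comp
    (tendsto_inv_atTop_nhdsGT_zero.comp (tendsto_natCast_atTop_atTop (R := ℝ)))
  refine hslope.congr' ?_
  filter_upwards [eventually_gt_atTop 0] with n hn
  have hn' : (n : ℝ) ≠ 0 := by positivity
  have : (n : ℝ) - c = n * (1 - c * (n : ℝ)⁻¹) := by field_simp
  rw [this, mul_pow]
  simp only [Function.comp_apply, inv_inv, zero_add, mul_zero, sub_zero, one_pow, smul_eq_mul]
  field_simp
  ring

theorem exists_forall_abs_le_of_abs_sub_le {c d : ℕ} (hc : 0 < c) {h : ℕ → ℝ} {ε : ℝ} (hε : 0 ≤ ε)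
    (hh : ∀ᶠ n : ℕ in atTop, |h n - h (n - c)| ≤ ε * (n : ℝ) ^ d) :
    ∃ M, ∀ n, |h n| ≤ M + ε * (n : ℝ) ^ (d + 1) := by
  obtain ⟨N, hN⟩ := eventually_atTop.1 hh
  refine ⟨∑ i ∈ range (N + c), |h i|, fun n => ?_⟩
  induction n using Nat.strong_induction_on with
  | _ n ih =>
    obtain hn | hn := lt_or_ge n (N + c)
    · have hle : |h n| ≤ ∑ i ∈ range (N + c), |h i| :=
        single_le_sum (f := fun i => |h i|) (fun i _ => abs_nonneg _) (mem_range.2 hn)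
      exact le_add_of_le_of_nonneg hle (by positivity)
    · have hpow : ((n - c : ℕ) : ℝ) ^ (d + 1) + (n : ℝ) ^ d ≤ (n : ℝ) ^ (d + 1) := by
        have hle : ((n - c : ℕ) : ℝ) + 1 ≤ n := by norm_cast; omega
        calc ((n - c : ℕ) : ℝ) ^ (d + 1) + (n : ℝ) ^ d
            ≤ (n : ℝ) ^ d * ((n - c : ℕ) : ℝ) + (n : ℝ) ^ d := by
              rw [pow_succ]; gcongr; exact n.sub_le c
          _ = (n : ℝ) ^ d * (((n - c : ℕ) : ℝ) + 1) := by ring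
          _ ≤ (n : ℝ) ^ (d + 1) := by rw [pow_succ]; gcongr
      calc |h n| = |h (n - c) + (h n - h (n - c))| := by rw [add_sub_cancel]
        _ ≤ |h (n - c)| + |h n - h (n - c)| := abs_add_le _ _
        _ ≤ (∑ i ∈ range (N + c), |h i| + ε * ((n - c : ℕ) : ℝ) ^ (d + 1)) + ε * (n : ℝ) ^ d :=
            add_le_add (ih (n - c) (by omega)) (hN n (by omega))
        _ = ∑ i ∈ range (N + c), |h i| + ε * (((n - c : ℕ) : ℝ) ^ (d + 1) + (n : ℝ) ^ d) := by ring
        _ ≤ _ := by gcongr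

theorem isLittleO_pow_succ_of_sub {c d : ℕ} (hc : 0 < c) {h : ℕ → ℝ}
    (hh : (fun n => h n - h (n - c)) =o[atTop] fun n => (n : ℝ) ^ d) :
    h =o[atTop] fun n => (n : ℝ) ^ (d + 1) := by
  refine isLittleO_iff.2 fun ε hε => ?_
  obtain ⟨M, hM⟩ : ∃ M, ∀ n, |h n| ≤ M + ε / 2 * (n : ℝ) ^ (d + 1) := by
    refine exists_forall_abs_le_of_abs_sub_le hc (half_pos hε).le ?_
    simpa using isLittleO_iff.1 hh (half_pos hε)
  have hpow : Tendsto (fun n : ℕ => ε / 2 * (n : ℝ) ^ (d + 1)) atTop atTop :=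
    ((tendsto_pow_atTop d.succ_ne_zero).comp tendsto_natCast_atTop_atTop).const_mul_atTop
      (half_pos hε)
  filter_upwards [hpow.eventually_ge_atTop M] with n hn
  rw [Real.norm_eq_abs, Real.norm_of_nonneg (by positivity)]
  linarith [hM n]

theorem exists_tendsto_div_pow_succ_of_sub {c d : ℕ} (hc : 0 < c) {f : ℕ → ℝ} {a : ℝ}
    (hf : Tendsto (fun n : ℕ => (f n - f (n - c)) / (n : ℝ) ^ d) atTop (𝓝 a)) :
    ∃ b, Tendsto (fun n : ℕ => f n / (n : ℝ) ^ (d + 1)) atTop (𝓝 b) := by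
  have hcd : (c : ℝ) * (d + 1) ≠ 0 := by positivity
  set b : ℝ := a / (c * (d + 1)) with hb
  have hpow (m : ℕ) : ∀ᶠ n : ℕ in atTop, (n : ℝ) ^ m ≠ 0 :=
    (eventually_gt_atTop 0).mono fun n hn => by positivity
  have hsub : (fun n => f n - b * (n : ℝ) ^ (d + 1)) =o[atTop] fun n => (n : ℝ) ^ (d + 1) := by
    refine isLittleO_pow_succ_of_sub hc ((isLittleO_iff_tendsto' ?_).2 ?_)
    · filter_upwards [hpow d] with n hn h0 using absurd h0 hn
    · have hlim := hf.sub ((tendsto_pow_sub_pow_div c d).const_mul b)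
      rw [hb, div_mul_cancel₀ _ hcd, sub_self] at hlim
      refine hlim.congr' ?_
      filter_upwards [eventually_ge_atTop c] with n hnc
      rw [Nat.cast_sub hnc]
      ring
  refine ⟨b, ?_⟩
  have hlim := hsub.tendsto_div_nhds_zero.add_const b
  rw [zero_add] at hlim
  refine hlim.congr' ?_
  filter_upwards [hpow (d + 1)] with n hn
  field_simp
  ring

theorem coeff_one_sub_X_pow_mul {R : Type*} [CommRing R] (F : R⟦X⟧) {c n : ℕ} (h : c ≤ n) :
    PowerSeries.coeff n ((1 - PowerSeries.X ^ c) * F) =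
      PowerSeries.coeff n F - PowerSeries.coeff (n - c) F := by
  rw [sub_mul, one_mul, map_sub, PowerSeries.coeff_X_pow_mul', if_pos h]

theorem exists_tendsto_coeff_div_pow {k : ℕ} {F : ℝ⟦X⟧}
    (hF : F ∈ fractionSeries (qPochhammer ℝ (k + 1))) :
    ∃ a, Tendsto (fun n : ℕ => PowerSeries.coeff n F / (n : ℝ) ^ k) atTop (𝓝 a) := by
  induction k generalizing F with
  | zero =>
    obtain ⟨N, hN⟩ := eventually_atTop.1 (mem_fractionSeries_iff_eventually.1 hF)
    have hconst : ∀ n ≥ N, PowerSeries.coeff n F = PowerSeries.coeff N F := by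
      intro n hn
      induction n, hn using Nat.le_induction with
      | base => rfl
      | succ n hn ih =>
        have h := hN (n + 1) (by omega)
        rw [coe_qPochhammer] at h
        simp only [zero_add, Icc_self, prod_singleton] at h
        rw [coeff_one_sub_X_pow_mul F (by omega), Nat.add_sub_cancel, sub_eq_zero] at h
        rw [h, ih]
    refine ⟨PowerSeries.coeff N F, tendsto_const_nhds.congr' ?_⟩
    filter_upwards [eventually_ge_atTop N] with n hn
    rw [hconst n hn, pow_zero, div_one]
  | succ k ih =>
    rw [qPochhammer_succ, ← smul_mem_fractionSeries] at hF
    obtain ⟨a, ha⟩ := ih hF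
    refine exists_tendsto_div_pow_succ_of_sub (c := k + 1 + 1) (by omega) (ha.congr' ?_)
    filter_upwards [eventually_ge_atTop (k + 1 + 1)] with n hn
    rw [← coeff_one_sub_X_pow_mul F hn, polynomial_smul_eq_coe_mul]
    simp

theorem pos_of_tendsto_div_pow {k : ℕ} {f : ℕ → ℕ} {a : ℝ}
    (ha : Tendsto (fun n : ℕ => (f n : ℝ) / (n : ℝ) ^ k) atTop (𝓝 a))
    (hpow : (fun n : ℕ => (n : ℝ) ^ k) =O[atTop] fun n => (f n : ℝ)) : 0 < a := by
  have hne : ∀ᶠ n : ℕ in atTop, (n : ℝ) ^ k ≠ 0 :=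
    (eventually_gt_atTop 0).mono fun n hn => by positivity
  refine lt_of_le_of_ne (ge_of_tendsto' ha fun n => by positivity) ?_
  rintro rfl
  have hsmall : (fun n => (f n : ℝ)) =o[atTop] fun n : ℕ => (n : ℝ) ^ k :=
    (isLittleO_iff_tendsto' (hne.mono fun n hn h0 => absurd h0 hn)).2 ha
  exact isLittleO_irrefl hne.frequently (hpow.trans_isLittleO hsmall)

theorem exists_isEquivalent_mul_zpow {k : ℕ} {f : ℕ → ℕ}
    (hf : PowerSeries.mk (fun n => (f n : ℤ)) ∈ fractionSeries (qPochhammer ℤ k))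
    (hpow : 1 ≤ k → (fun n : ℕ => (n : ℝ) ^ (k - 1)) =O[atTop] fun n => (f n : ℝ)) :
    ∃ a : ℝ, 0 ≤ a ∧ (1 ≤ k → 0 < a) ∧
      (fun n => (f n : ℝ)) ~[atTop] fun n => a * (n : ℝ) ^ ((k : ℤ) - 1) := by
  cases k with
  | zero =>
    refine ⟨0, le_rfl, by simp, ?_⟩
    simp only [zero_mul]
    refine isEquivalent_zero_iff_eventually_zero.2 ?_
    filter_upwards [mem_fractionSeries_iff_eventually.1 hf] with n hn
    simpa [coe_qPochhammer] using hn
  | succ k =>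
    obtain ⟨a, ha⟩ : ∃ a : ℝ, Tendsto (fun n => (f n : ℝ) / (n : ℝ) ^ k) atTop (𝓝 a) := by
      have hmap := map_mem_fractionSeries (Int.castRingHom ℝ) hf
      rw [map_qPochhammer] at hmap
      simpa using exists_tendsto_coeff_div_pow hmap
    have hpos : 0 < a := pos_of_tendsto_div_pow ha (hpow (Nat.le_add_left 1 k))
    refine ⟨a, hpos.le, fun _ => hpos, ?_⟩
    simp only [Nat.cast_add, Nat.cast_one, add_sub_cancel_right, zpow_natCast]
    refine isEquivalent_of_tendsto_one ?_
    have hlim := ha.div_const a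
    rw [div_self hpos.ne'] at hlim
    exact hlim.congr fun n => by rw [div_div, mul_comm]; rfl

end Asymptotics

instance wellFoundedLT_lowerSet {α : Type*} [Preorder α] [WellQuasiOrderedLE α] :
    WellFoundedLT (LowerSet α) := by
  refine ⟨RelEmbedding.wellFounded_iff_isEmpty.2 ⟨fun f => ?_⟩⟩
  have hanti : StrictAnti f := fun i j h => f.map_rel_iff.2 h
  have h (i : ℕ) : ∃ x ∈ f i, x ∉ f (i + 1) :=
    Set.not_subset.1 (LowerSet.coe_subset_coe.not.2 (hanti i.lt_succ_self).not_ge)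
  choose x hx hx' using h
  obtain ⟨i, j, hij, hle⟩ := wellQuasiOrdered_le x
  exact hx' i (hanti.antitone hij ((f j).lower hle (hx j)))

section LowerSets

variable {ι : Type*}

/-- The set `Y` of integer vectors contains vectors whose entries with index in `A` are all
arbitrarily large. For a lower set, `#A` is then the dimension of an orthant it contains. -/
def IsUnboundedAlong (Y : Set (ι → ℕ)) (A : Finset ι) : Prop :=
  ∀ N : ℕ, ∃ μ ∈ Y, ∀ i ∈ A, N ≤ μ i

theorem IsUnboundedAlong.mono {Y Z : Set (ι → ℕ)} {A : Finset ι} (h : IsUnboundedAlong Y A)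
    (hYZ : Y ⊆ Z) : IsUnboundedAlong Z A := fun N =>
  (h N).imp fun _ => And.imp_left (@hYZ _)

/-- The part of a lower set of integer vectors that lies in the `i`-th coordinate hyperplane. -/
def lowerFace (i : ι) (Y : LowerSet (ι → ℕ)) : LowerSet (ι → ℕ) where
  carrier := {μ | μ ∈ Y ∧ μ i = 0}
  lower' _ _ h hμ := ⟨Y.lower h hμ.1, Nat.eq_zero_of_le_zero (hμ.2 ▸ h i)⟩

theorem lowerFace_le (i : ι) (Y : LowerSet (ι → ℕ)) : lowerFace i Y ≤ Y := fun _ hμ => hμ.1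

theorem IsUnboundedAlong.notMem_of_lowerFace {i : ι} {Y : LowerSet (ι → ℕ)} {A : Finset ι}
    (hA : IsUnboundedAlong (lowerFace i Y) A) : i ∉ A := fun hi => by
  obtain ⟨μ, hμ, h⟩ := hA 1
  exact absurd hμ.2 (Nat.one_le_iff_ne_zero.1 (h i hi))

section Shift

variable [DecidableEq ι]

/-- The part of a lower set of integer vectors off the `i`-th coordinate hyperplane, translated
by one step towards that hyperplane. -/
def lowerShift (i : ι) (Y : LowerSet (ι → ℕ)) : LowerSet (ι → ℕ) where
  carrier := {μ | μ + Pi.single i 1 ∈ Y}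
  lower' _ _ h hμ := Y.lower (add_le_add_left h _) hμ

theorem lowerShift_le (i : ι) (Y : LowerSet (ι → ℕ)) : lowerShift i Y ≤ Y := fun _ hμ =>
  Y.lower le_self_add hμ

theorem add_single_mem_of_lowerShift_eq {i : ι} {Y : LowerSet (ι → ℕ)} (h : lowerShift i Y = Y)
    {μ : ι → ℕ} (hμ : μ ∈ Y) (N : ℕ) : μ + Pi.single i N ∈ Y := by
  induction N with
  | zero => simpa using hμ
  | succ N ih =>
    rw [← h] at ih
    rwa [Pi.single_add, ← add_assoc]

theorem IsUnboundedAlong.insert_of_lowerFace {i : ι} {Y : LowerSet (ι → ℕ)} {A : Finset ι}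
    (hA : IsUnboundedAlong (lowerFace i Y) A) (h : lowerShift i Y = Y) :
    IsUnboundedAlong Y (insert i A) := fun N => by
  obtain ⟨μ, hμ, hN⟩ := hA N
  refine ⟨μ + Pi.single i N, add_single_mem_of_lowerShift_eq h hμ.1 N, fun j hj => ?_⟩
  obtain rfl | hj := mem_insert.1 hj
  · simp
  · exact (hN j hj).trans (Nat.le_add_right _ _)

end Shift

variable [Fintype ι]

/-- The vectors `μ` of `Y` for which the numbers `μ i + 1` with the weights `w i` add up to `n`. -/
def weightLevel (w : ι → ℕ) (Y : Set (ι → ℕ)) (n : ℕ) : Set (ι → ℕ) :=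
  {μ ∈ Y | ∑ i, w i * (μ i + 1) = n}

/-- The generating series of the numbers of vectors of `Y` of given weight. -/
noncomputable def weightSeries (w : ι → ℕ) (Y : Set (ι → ℕ)) : ℤ⟦X⟧ :=
  PowerSeries.mk fun n => ((weightLevel w Y n).ncard : ℤ)

variable {w : ι → ℕ}

theorem weight_le_sum (μ : ι → ℕ) (i : ι) : w i * (μ i + 1) ≤ ∑ j, w j * (μ j + 1) :=
  single_le_sum_of_canonicallyOrdered (f := fun j => w j * (μ j + 1)) (mem_univ i)

theorem finite_weightLevel (hw : ∀ i, 0 < w i) (Y : Set (ι → ℕ)) (n : ℕ) :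
    (weightLevel w Y n).Finite := by
  classical
  refine (Set.finite_Iic fun _ => n).subset fun μ hμ i => ?_
  calc μ i ≤ μ i + 1 := Nat.le_succ _
    _ ≤ w i * (μ i + 1) := Nat.le_mul_of_pos_left _ (hw i)
    _ ≤ ∑ j, w j * (μ j + 1) := weight_le_sum μ i
    _ = n := hμ.2

theorem sum_weight_add_single [DecidableEq ι] (μ : ι → ℕ) (i : ι) :
    ∑ j, w j * ((μ + Pi.single i 1 : ι → ℕ) j + 1) = ∑ j, w j * (μ j + 1) + w i := by
  have h (j : ι) : w j * ((μ + Pi.single i 1 : ι → ℕ) j + 1) =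
      w j * (μ j + 1) + if i = j then w j else 0 := by
    simp only [Pi.add_apply, Pi.single_apply, eq_comm (a := j)]
    split_ifs <;> ring
  simp only [h, sum_add_distrib, sum_ite_eq, mem_univ, if_true]

theorem weightLevel_eq_union [DecidableEq ι] (Y : LowerSet (ι → ℕ)) (i : ι) (n : ℕ) :
    weightLevel w Y (n + w i) = weightLevel w (lowerFace i Y) (n + w i) ∪
      (· + Pi.single i 1) '' weightLevel w (lowerShift i Y) n := by
  ext μ
  constructor
  · rintro ⟨hμ, hn⟩
    by_cases h : μ i = 0
    · exact Or.inl ⟨⟨hμ, h⟩, hn⟩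
    · have hμ' : μ - Pi.single i 1 + Pi.single i 1 = μ :=
        tsub_add_cancel_of_le
          (update_le_iff.2 ⟨Nat.one_le_iff_ne_zero.2 h, fun _ _ => Nat.zero_le _⟩)
      refine Or.inr ⟨μ - Pi.single i 1, ⟨?_, ?_⟩, hμ'⟩
      · change μ - Pi.single i 1 + Pi.single i 1 ∈ Y
        rwa [hμ']
      · rwa [← hμ', sum_weight_add_single, add_left_inj] at hn
  · rintro (⟨hμ, hn⟩ | ⟨μ, ⟨hμ, hn⟩, rfl⟩)
    · exact ⟨hμ.1, hn⟩
    · exact ⟨hμ, by rw [sum_weight_add_single, hn]⟩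

theorem weightSeries_eq_add [DecidableEq ι] (hw : ∀ i, 0 < w i) (Y : LowerSet (ι → ℕ)) (i : ι) :
    weightSeries w Y =
      weightSeries w (lowerFace i Y) + PowerSeries.X ^ w i * weightSeries w (lowerShift i Y) := by
  ext n
  rw [map_add, PowerSeries.coeff_X_pow_mul']
  simp only [weightSeries, PowerSeries.coeff_mk]
  split_ifs with hn
  · obtain ⟨n, rfl⟩ := Nat.exists_eq_add_of_le' hn
    rw [Nat.add_sub_cancel, weightLevel_eq_union, Set.ncard_union_eq ?_
      (finite_weightLevel hw _ _) ((finite_weightLevel hw _ _).image _),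
      Set.ncard_image_of_injective _ (add_left_injective _), Nat.cast_add]
    rw [Set.disjoint_left]
    rintro _ ⟨⟨-, h⟩, -⟩ ⟨μ, -, rfl⟩
    simp at h
  · have : weightLevel w Y n = weightLevel w (lowerFace i Y) n := by
      refine Set.Subset.antisymm (fun μ hμ => absurd ?_ hn) fun μ hμ => ⟨hμ.1.1, hμ.2⟩
      exact ((Nat.le_mul_of_pos_right _ (Nat.succ_pos _)).trans (hμ.2 ▸ weight_le_sum μ i))
    rw [this, add_zero]

theorem weightSeries_mem_fractionSeries_of_subset_zero {Y : Set (ι → ℕ)} (hY : Y ⊆ {0}) (q : ℤ[X]) :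
    weightSeries w Y ∈ fractionSeries q := by
  refine fractionSeries_mono (one_dvd q) (mem_fractionSeries_iff_eventually.2 ?_)
  filter_upwards [eventually_gt_atTop (∑ i, w i)] with n hn
  have : weightLevel w Y n = ∅ := by
    refine Set.eq_empty_of_forall_notMem fun μ hμ => hn.ne' ?_
    simpa [Set.mem_singleton_iff.1 (hY hμ.1)] using hμ.2.symm
  simp [weightSeries, this]

theorem weightSeries_mem_fractionSeries (hw : ∀ i, 0 < w i) (Y : LowerSet (ι → ℕ)) {k : ℕ}
    (hk : ∀ A, IsUnboundedAlong (Y : Set (ι → ℕ)) A → ∑ i ∈ A, w i ≤ k) :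
    weightSeries w Y ∈ fractionSeries (qPochhammer ℤ k) := by
  induction Y using WellFoundedLT.induction generalizing k with | _ Y ih
  classical
  by_cases hface : ∀ i, lowerFace i Y = Y
  · refine weightSeries_mem_fractionSeries_of_subset_zero (fun μ hμ => funext fun i => ?_) _
    rw [← hface i] at hμ
    exact hμ.2
  obtain ⟨i, hi⟩ := not_forall.1 hface
  have hlt : lowerFace i Y < Y := (lowerFace_le i Y).lt_of_ne hi
  obtain hshift | hshift := (lowerShift_le i Y).lt_or_eq
  · rw [weightSeries_eq_add hw Y i]
    refine add_mem (ih _ hlt fun A hA => hk A (hA.mono (lowerFace_le i Y))) ?_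
    rw [← Polynomial.coe_X, ← Polynomial.coe_pow, ← polynomial_smul_eq_coe_mul]
    exact Submodule.smul_mem _ _ (ih _ hshift fun A hA => hk A (hA.mono (lowerShift_le i Y)))
  · -- `Y` is a cylinder over its face: the face has one unbounded direction less than `Y`, which
    -- leaves room in the denominator for the factor `1 - X ^ w i`.
    have hins (A : Finset ι) (hA : IsUnboundedAlong (lowerFace i Y : Set (ι → ℕ)) A) :
        w i + ∑ j ∈ A, w j ≤ k := by
      rw [← sum_insert hA.notMem_of_lowerFace]
      exact hk _ (hA.insert_of_lowerFace hshift)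
    obtain ⟨μ, hμ, -⟩ := Set.exists_of_ssubset (LowerSet.coe_ssubset_coe.2 hlt)
    have hzero : (0 : ι → ℕ) ∈ lowerFace i Y := ⟨Y.lower zero_le hμ, rfl⟩
    obtain ⟨j, rfl⟩ : ∃ j, k = j + w i := Nat.exists_eq_add_of_le'
      ((Nat.le_add_right _ _).trans (hins ∅ fun _ => ⟨0, hzero, by simp⟩))
    refine fractionSeries_mono (qPochhammer_mul_dvd (hw i) j) (smul_mem_fractionSeries.1 ?_)
    have heq : (1 - Polynomial.X ^ w i : ℤ[X]) • weightSeries w Y =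
        weightSeries w (lowerFace i Y) := by
      rw [polynomial_smul_eq_coe_mul]
      have := weightSeries_eq_add hw Y i
      rw [hshift] at this
      simp only [Polynomial.coe_sub, Polynomial.coe_one, Polynomial.coe_pow, Polynomial.coe_X]
      linear_combination this
    rw [heq]
    exact ih _ hlt fun A hA => by have := hins A hA; omega

theorem mk_ncard_comp_mem_fractionSeries {κ : Type*} {π : ι → κ} (hπ : π.Surjective)
    (Y : LowerSet (ι → ℕ)) {k : ℕ} (hk : ∀ A, IsUnboundedAlong (Y : Set (ι → ℕ)) A → #A ≤ k) :
    PowerSeries.mk (fun n => ({l ∈ weightLevel 1 Y n | ∃ μ, l = μ ∘ π}.ncard : ℤ)) ∈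
      fractionSeries (qPochhammer ℤ k) := by
  classical
  have := Fintype.ofSurjective π hπ
  let w (j : κ) : ℕ := #{i | π i = j}
  let Z : LowerSet (κ → ℕ) := ⟨{μ | μ ∘ π ∈ Y}, fun _ _ h hμ => Y.lower (fun i => h (π i)) hμ⟩
  have hw (j : κ) : 0 < w j := card_pos.2 ((hπ j).imp fun i hi => by simpa using hi)
  have hsum (μ : κ → ℕ) : ∑ j, w j * (μ j + 1) = ∑ i, 1 * (μ (π i) + 1) := by
    simp only [one_mul, ← sum_fiberwise' univ π fun j => μ j + 1, sum_const, smul_eq_mul, w]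
  have hZ (n : ℕ) :
      (· ∘ π) '' weightLevel w Z n = {l ∈ weightLevel 1 Y n | ∃ μ, l = μ ∘ π} := by
    ext l
    constructor
    · rintro ⟨μ, ⟨hμ, rfl⟩, rfl⟩
      exact ⟨⟨hμ, (hsum μ).symm⟩, μ, rfl⟩
    · rintro ⟨⟨hl, hn⟩, μ, rfl⟩
      exact ⟨μ, ⟨hl, (hsum μ).trans hn⟩, rfl⟩
  have hZk : weightSeries w Z ∈ fractionSeries (qPochhammer ℤ k) := by
    refine weightSeries_mem_fractionSeries hw Z fun A hA => ?_
    refine (sum_card_fiberwise_eq_card_filter univ A π).trans_le (hk _ fun N => ?_)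
    obtain ⟨μ, hμ, hN⟩ := hA N
    exact ⟨μ ∘ π, hμ, fun i hi => hN (π i) (mem_filter.1 hi).2⟩
  have hinj : Function.Injective fun μ : κ → ℕ => μ ∘ π := hπ.injective_comp_right
  simpa only [weightSeries, ← hZ, Set.ncard_image_of_injective _ hinj] using hZk

end LowerSets

section OrbitCounting

variable {G ι X : Type*} [Group G] [MulAction G ι] [MulAction Gᵈᵐᵃ X]

theorem smul_eq_self_iff_exists_comp {β : Type*} (g : G) (l : ι → β) :
    DomMulAct.mk g • l = l ↔
      ∃ μ, l = μ ∘ Quotient.mk (MulAction.orbitRel (Subgroup.zpowers g) ι) := by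
  constructor
  · intro h
    refine ⟨Quotient.lift l ?_, rfl⟩
    rintro _ i ⟨⟨_, m, rfl⟩, rfl⟩
    have hm : DomMulAct.mk (g ^ m) • l = l :=
      (MulAction.stabilizer Gᵈᵐᵃ l).zpow_mem (MulAction.mem_stabilizer_iff.2 h) m
    exact congrFun hm i
  · rintro ⟨μ, rfl⟩
    exact funext fun i => congrArg μ (Quotient.sound ⟨⟨g, Subgroup.mem_zpowers g⟩, rfl⟩)

theorem pow_le_factorial_mul_card_finsuppAntidiag [DecidableEq ι] {A : Finset ι} {k : ℕ}
    (hA : #A = k + 1) (N : ℕ) : N ^ k ≤ k.factorial * #(A.finsuppAntidiag N) := by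
  calc N ^ k ≤ (N + 1) ^ k := Nat.pow_le_pow_left N.le_succ k
    _ ≤ (N + 1).ascFactorial k := Nat.pow_succ_le_ascFactorial _ _
    _ = k.factorial * (N + k).choose k := Nat.ascFactorial_eq_factorial_mul_choose N k
    _ = k.factorial * #(A.finsuppAntidiag N) := by
      rw [card_finsuppAntidiag_nat_eq_choose, hA, ← Nat.choose_symm_add, Nat.add_right_comm,
        Nat.add_sub_cancel, Nat.add_comm k]

variable [Fintype ι]

/-- The pairs of an element of `X` and an integer vector in `Y` for which the entries of the
vector, each increased by one, add up to `n`. -/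
def configurations (Y : SubMulAction Gᵈᵐᵃ (X × (ι → ℕ))) (n : ℕ) :
    SubMulAction Gᵈᵐᵃ (X × (ι → ℕ)) where
  carrier := {p | p.2 ∈ weightLevel 1 (Prod.mk p.1 ⁻¹' Y) n}
  smul_mem' c p hp := by
    refine ⟨Y.smul_mem c hp.1, ?_⟩
    rw [← hp.2]
    exact Equiv.sum_comp (MulAction.toPerm (DomMulAct.mk.symm c)) fun i => 1 * (p.2 i + 1)

/-- The generating series of the numbers of orbits of configurations. -/
noncomputable def orbitSeries (Y : SubMulAction Gᵈᵐᵃ (X × (ι → ℕ))) : ℤ⟦X⟧ :=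
  PowerSeries.mk fun n =>
    (Nat.card (MulAction.orbitRel.Quotient Gᵈᵐᵃ (configurations Y n)) : ℤ)

theorem finite_configurations [Finite X] (Y : SubMulAction Gᵈᵐᵃ (X × (ι → ℕ))) (n : ℕ) :
    Finite (configurations Y n) := by
  have hfin := (Set.finite_univ (α := X)).prod
    (finite_weightLevel (w := 1) (fun _ => one_pos) (Set.univ : Set (ι → ℕ)) n)
  exact (hfin.subset fun p hp => ⟨trivial, trivial, hp.2⟩).to_subtype

theorem card_fixedBy_configurations [Fintype X] [DecidableEq X]
    (Y : SubMulAction Gᵈᵐᵃ (X × (ι → ℕ))) (n : ℕ) (g : G) :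
    Nat.card (MulAction.fixedBy (configurations Y n) (DomMulAct.mk g)) =
      ∑ x : X with DomMulAct.mk g • x = x, {l ∈ weightLevel 1 (Prod.mk x ⁻¹' Y) n |
        ∃ μ, l = μ ∘ Quotient.mk (MulAction.orbitRel (Subgroup.zpowers g) ι)}.ncard := by
  simp only [← smul_eq_self_iff_exists_comp, ← Nat.card_coe_set_eq]
  have hfin (x : X) : Finite {l ∈ weightLevel 1 (Prod.mk x ⁻¹' (Y : Set (X × (ι → ℕ)))) n |
      DomMulAct.mk g • l = l} :=
    ((finite_weightLevel (fun _ => one_pos) _ n).subset fun _ h => h.1).to_subtype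
  rw [sum_subtype _ (fun x => mem_filter_univ x), ← Nat.card_sigma]
  exact Nat.card_congr
    { toFun p := ⟨⟨p.1.1.1, congrArg (fun q => q.1.1) p.2⟩, p.1.1.2, p.1.2,
        congrArg (fun q => q.1.2) p.2⟩
      invFun q := ⟨⟨(q.1.1, q.2.1), q.2.2.1⟩, Subtype.ext (Prod.ext q.1.2 q.2.2.2)⟩
      left_inv _ := rfl
      right_inv _ := rfl }

theorem sum_card_fixedBy_configurations [Fintype G] [Finite X]
    (Y : SubMulAction Gᵈᵐᵃ (X × (ι → ℕ))) (n : ℕ) :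
    ∑ g : G, Nat.card (MulAction.fixedBy (configurations Y n) (DomMulAct.mk g)) =
      Nat.card (MulAction.orbitRel.Quotient Gᵈᵐᵃ (configurations Y n)) * Fintype.card G := by
  classical
  have := finite_configurations Y n
  have := Fintype.ofFinite (configurations Y n)
  have := Fintype.ofEquiv G DomMulAct.mk
  have h := MulAction.sum_card_fixedBy_eq_card_orbits_mul_card_group Gᵈᵐᵃ (configurations Y n)
  simp only [← Nat.card_eq_fintype_card] at h
  rw [← Nat.card_eq_fintype_card, Nat.card_congr (α := G) DomMulAct.mk]
  exact (Equiv.sum_comp DomMulAct.mk fun c => Nat.card (MulAction.fixedBy _ c)).trans h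

theorem orbitSeries_mem_fractionSeries [Finite G] [Finite X] {Y : SubMulAction Gᵈᵐᵃ (X × (ι → ℕ))}
    (hY : ∀ x, IsLowerSet (Prod.mk x ⁻¹' (Y : Set (X × (ι → ℕ))))) {k : ℕ}
    (hk : ∀ x A, IsUnboundedAlong (Prod.mk x ⁻¹' (Y : Set (X × (ι → ℕ)))) A → #A ≤ k) :
    orbitSeries Y ∈ fractionSeries (qPochhammer ℤ k) := by
  classical
  have := Fintype.ofFinite G
  have := Fintype.ofFinite X
  refine mem_fractionSeries_of_nsmul (Fintype.card_ne_zero (α := G)) ?_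
  have hburnside : Fintype.card G • orbitSeries Y = ∑ g : G, ∑ x : X with DomMulAct.mk g • x = x,
      PowerSeries.mk fun n => ({l ∈ weightLevel 1 (Prod.mk x ⁻¹' (Y : Set (X × (ι → ℕ)))) n |
        ∃ μ, l = μ ∘ Quotient.mk (MulAction.orbitRel (Subgroup.zpowers g) ι)}.ncard : ℤ) := by
    ext n
    simp only [orbitSeries, map_nsmul, map_sum, PowerSeries.coeff_mk]
    rw [nsmul_eq_mul, mul_comm]
    exact_mod_cast (sum_card_fixedBy_configurations Y n).symm.trans
      (sum_congr rfl fun g _ => card_fixedBy_configurations Y n g)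
  rw [hburnside]
  exact sum_mem fun g _ => sum_mem fun x _ =>
    mk_ncard_comp_mem_fractionSeries Quotient.mk_surjective ⟨_, hY x⟩ (hk x)

theorem card_configurations_le [Finite G] [Finite X] (Y : SubMulAction Gᵈᵐᵃ (X × (ι → ℕ))) (n : ℕ) :
    Nat.card (configurations Y n) ≤
      Nat.card (MulAction.orbitRel.Quotient Gᵈᵐᵃ (configurations Y n)) * Nat.card G := by
  have := Fintype.ofFinite G
  rw [Nat.card_eq_fintype_card (α := G), ← sum_card_fixedBy_configurations]
  calc Nat.card (configurations Y n)
      = Nat.card (MulAction.fixedBy (configurations Y n) (DomMulAct.mk (1 : G))) := by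
        rw [DomMulAct.mk_one, MulAction.fixedBy_one_eq_univ, Nat.card_univ]
    _ ≤ _ := single_le_sum_of_canonicallyOrdered
        (f := fun g : G => Nat.card (MulAction.fixedBy (configurations Y n) (DomMulAct.mk g)))
        (mem_univ 1)

theorem card_finsuppAntidiag_le_card_configurations [Finite X] [DecidableEq ι]
    {Y : SubMulAction Gᵈᵐᵃ (X × (ι → ℕ))} {x : X}
    (hY : IsLowerSet (Prod.mk x ⁻¹' (Y : Set (X × (ι → ℕ))))) {A : Finset ι}
    (hA : IsUnboundedAlong (Prod.mk x ⁻¹' (Y : Set (X × (ι → ℕ)))) A) (N : ℕ) :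
    #(A.finsuppAntidiag N) ≤ Nat.card (configurations Y (N + Fintype.card ι)) := by
  have := finite_configurations Y (N + Fintype.card ι)
  have hmem (f : A.finsuppAntidiag N) :
      (x, (f : ι → ℕ)) ∈ configurations Y (N + Fintype.card ι) := by
    obtain ⟨hsum, hsupp⟩ := mem_finsuppAntidiag.1 f.2
    refine ⟨?_, ?_⟩
    · obtain ⟨μ, hμ, hN⟩ := hA N
      refine hY (fun i => ?_) hμ
      by_cases hi : i ∈ A
      · exact ((single_le_sum_of_canonicallyOrdered hi).trans_eq hsum).trans (hN i hi)
      · simp [Finsupp.notMem_support_iff.1 fun h => hi (hsupp h)]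
    · have hsum' : ∑ i, (f : ι →₀ ℕ) i = N := (sum_subset A.subset_univ fun i _ hi =>
        Finsupp.notMem_support_iff.1 fun h => hi (hsupp h)).symm.trans hsum
      simp [sum_add_distrib, hsum']
  rw [← Fintype.card_coe, ← Nat.card_eq_fintype_card]
  refine Nat.card_le_card_of_injective (fun f => ⟨_, hmem f⟩) fun f g h => ?_
  exact Subtype.ext (DFunLike.coe_injective (congrArg (fun p => p.1.2) h))

theorem pow_isBigO_card_orbits [Finite G] [Finite X] {Y : SubMulAction Gᵈᵐᵃ (X × (ι → ℕ))} {x : X}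
    (hY : IsLowerSet (Prod.mk x ⁻¹' (Y : Set (X × (ι → ℕ))))) {A : Finset ι}
    (hA : IsUnboundedAlong (Prod.mk x ⁻¹' (Y : Set (X × (ι → ℕ)))) A) {k : ℕ} (hk : #A = k + 1) :
    (fun n : ℕ => (n : ℝ) ^ k) =O[atTop] fun n =>
      (Nat.card (MulAction.orbitRel.Quotient Gᵈᵐᵃ (configurations Y n)) : ℝ) := by
  classical
  refine IsBigO.of_bound ((2 ^ k * k.factorial * Nat.card G : ℕ) : ℝ) ?_
  filter_upwards [eventually_ge_atTop (2 * Fintype.card ι)] with n hn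
  rw [Real.norm_of_nonneg (by positivity), Real.norm_of_nonneg (by positivity)]
  obtain ⟨N, rfl⟩ : ∃ N, n = N + Fintype.card ι := Nat.exists_eq_add_of_le' (by omega)
  norm_cast
  calc (N + Fintype.card ι) ^ k ≤ (2 * N) ^ k := Nat.pow_le_pow_left (by omega) k
    _ = 2 ^ k * N ^ k := mul_pow _ _ _
    _ ≤ 2 ^ k * (k.factorial * #(A.finsuppAntidiag N)) := by
      gcongr
      exact pow_le_factorial_mul_card_finsuppAntidiag hk N
    _ ≤ 2 ^ k * (k.factorial * (Nat.card (MulAction.orbitRel.Quotient Gᵈᵐᵃ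
        (configurations Y (N + Fintype.card ι))) * Nat.card G)) := by
      gcongr
      exact (card_finsuppAntidiag_le_card_configurations hY hA N).trans (card_configurations_le Y _)
    _ = _ := by ring

end OrbitCounting

theorem exists_equiv_fst_eq_of_sigma_equiv {ι ι' : Type*} {W : ι → Type*} {W' : ι' → Type*}
    [∀ i, Nonempty (W i)] [∀ i, Nonempty (W' i)]
    (e : (Σ i, W i) ≃ Σ i, W' i) (he : ∀ x y, (e x).1 = (e y).1 ↔ x.1 = y.1) :
    ∃ σ : ι ≃ ι', ∀ x, (e x).1 = σ x.1 := by
  have hp (i : ι) : ∃ x : Σ i, W i, x.1 = i := ⟨⟨i, Classical.arbitrary _⟩, rfl⟩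
  choose p hp using hp
  have hfst (x : Σ i, W i) : (e x).1 = (e (p x.1)).1 := (he _ _).2 (hp _).symm
  have hinj : Function.Injective fun i => (e (p i)).1 := fun i j h => by
    rw [← hp i, ← hp j]
    exact (he _ _).1 h
  have hsurj : Function.Surjective fun i => (e (p i)).1 := fun j => by
    obtain ⟨x, hx⟩ := e.surjective ⟨j, Classical.arbitrary _⟩
    exact ⟨x.1, (hfst x).symm.trans (congrArg Sigma.fst hx)⟩
  exact ⟨Equiv.ofBijective _ ⟨hinj, hsurj⟩, hfst⟩

namespace Tournament

variable {V V' ι ι' : Type*}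

section Basic

theorem adj_injective : Function.Injective (fun T : Tournament V => T.Adj) := by
  rintro ⟨⟨a⟩, _, _, _⟩ ⟨⟨b⟩, _, _, _⟩ h
  cases h
  rfl

instance [Finite V] : Finite (Tournament V) := Finite.of_injective _ adj_injective

/-- The pullback of a tournament along an injective map. -/
def comap (T : Tournament V) (f : V' → V) (hf : Function.Injective f) : Tournament V' where
  Adj x y := T.Adj (f x) (f y)
  irrefl x := T.irrefl (f x)
  antisymm _ _ h h' := hf (T.antisymm _ _ h h')
  complete _ _ h := T.complete _ _ (hf.ne h)

/-- The pullback of a tournament along a bijection is isomorphic to it. -/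
def comapIso (T : Tournament V) (e : V' ≃ V) : Iso (T.comap e e.injective) T :=
  ⟨e, Iff.rfl⟩

/-- The restriction of a tournament embeds into it. -/
def induceEmbedding (T : Tournament V) (A : Set V) : (T.induce A).Adj ↪r T.Adj :=
  ⟨Function.Embedding.subtype _, Iff.rfl⟩

theorem exists_finset_iso_of_embedding {T : Tournament V} {S : Tournament V'} [Finite V']
    (f : S.Adj ↪r T.Adj) :
    ∃ A : Finset V, #A = Nat.card V' ∧ Nonempty (Iso S (T.induce (A : Set V))) := by
  have := Fintype.ofFinite V'
  refine ⟨univ.map f.toEmbedding, by simp, ⟨⟨Equiv.ofBijective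
    (fun x => ⟨f x, by simp⟩) ⟨fun x y h => f.injective (Subtype.ext_iff.1 h), ?_⟩,
    f.map_rel_iff⟩⟩⟩
  rintro ⟨y, hy⟩
  obtain ⟨x, -, rfl⟩ := mem_map.1 (mem_coe.1 hy)
  exact ⟨x, rfl⟩

theorem adj_iff_not_adj (T : Tournament V) {x y : V} (h : x ≠ y) : T.Adj x y ↔ ¬ T.Adj y x :=
  ⟨fun hxy hyx => h (T.antisymm _ _ hxy hyx), (T.complete x y h).resolve_right⟩

theorem isAcyclic_induce {T : Tournament V} {A : Set V} : (T.induce A).IsAcyclic ↔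
    ∀ a ∈ A, ∀ b ∈ A, ∀ c ∈ A, ¬ (T.Adj a b ∧ T.Adj b c ∧ T.Adj c a) :=
  ⟨fun h a ha b hb c hc => h ⟨a, ha⟩ ⟨b, hb⟩ ⟨c, hc⟩, fun h a b c => h a a.2 b b.2 c c.2⟩

theorem IsAcyclic.of_embedding {T : Tournament V} {S : Tournament V'} (hS : S.IsAcyclic)
    (f : T.Adj ↪r S.Adj) : T.IsAcyclic := fun a b c h =>
  hS (f a) (f b) (f c) ⟨f.map_rel_iff.2 h.1, f.map_rel_iff.2 h.2.1, f.map_rel_iff.2 h.2.2⟩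

end Basic

section Chain

/-- The acyclic tournament `0 → 1 → ⋯ → n - 1`. -/
def chain (n : ℕ) : Tournament (Fin n) where
  Adj x y := x < y
  irrefl := lt_irrefl
  antisymm _ _ h h' := absurd h h'.asymm
  complete _ _ h := lt_or_gt_of_ne h

theorem isAcyclic_chain (n : ℕ) : (chain n).IsAcyclic :=
  fun _ _ _ h => lt_irrefl _ ((h.1.trans h.2.1).trans h.2.2)

theorem IsAcyclic.isStrictTotalOrder {T : Tournament V} (hT : T.IsAcyclic) :
    IsStrictTotalOrder V T.Adj where
  irrefl := T.irrefl
  trichotomous a b hab hba := by_contra fun h => (T.complete a b h).elim hab hba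
  trans a b c hab hbc := by
    have hac : a ≠ c := by
      rintro rfl
      obtain rfl := T.antisymm _ _ hab hbc
      exact T.irrefl a hab
    exact (T.complete a c hac).resolve_right fun hca => hT a b c ⟨hab, hbc, hca⟩

theorem IsAcyclic.nonempty_chain_iso {T : Tournament V} (hT : T.IsAcyclic) {n : ℕ}
    (hn : ENat.card V = n) : Nonempty (Iso (chain n) T) := by
  classical
  have : Finite V := ENat.card_lt_top.1 (hn ▸ ENat.natCast_lt_top n)
  have := Fintype.ofFinite V
  have := hT.isStrictTotalOrder
  let _ : LinearOrder V := linearOrderOfSTO T.Adj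
  have hcard : Fintype.card V = n := by
    rw [ENat.card_eq_coe_fintype_card] at hn
    exact_mod_cast hn
  let e : Fin n ≃o V := Fintype.orderIsoFinOfCardEq V hcard
  exact ⟨⟨e.toEquiv, e.lt_iff_lt⟩⟩

theorem IsAcyclic.nonempty_chain_embedding {T : Tournament V} (hT : T.IsAcyclic) {n : ℕ}
    (hn : n ≤ ENat.card V) : Nonempty ((chain n).Adj ↪r T.Adj) := by
  obtain ⟨A, -, hA⟩ := Set.exists_subset_encard_eq ((Set.encard_univ V).symm ▸ hn)
  exact ((hT.of_embedding (T.induceEmbedding A)).nonempty_chain_iso hA).map fun e =>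
    e.toRelEmbedding.trans (T.induceEmbedding A)

end Chain

section AcyclicComponent

variable {T : Tournament V} {x y z : V}

theorem IsAutonomous.adj_right_iff {A : Set V} (hA : T.IsAutonomous A)
    (hx : x ∈ A) (hy : y ∈ A) (hz : z ∉ A) : T.Adj z x ↔ T.Adj z y := by
  have hzx : z ≠ x := fun h => hz (h ▸ hx)
  have hzy : z ≠ y := fun h => hz (h ▸ hy)
  rw [T.adj_iff_not_adj hzx, T.adj_iff_not_adj hzy, hA x hx y hy z hz]

theorem IsAutonomous.not_adj_and_adj {A : Set V} (hA : T.IsAutonomous A)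
    (hx : x ∈ A) (hy : y ∈ A) (hz : z ∉ A) : ¬ (T.Adj x z ∧ T.Adj z y) := fun ⟨hxz, hzy⟩ =>
  hz (T.antisymm _ _ hzy ((hA x hx y hy z hz).1 hxz) ▸ hy)

theorem IsAutonomous.sUnion {𝒜 : Set (Set V)} (h : ∀ A ∈ 𝒜, T.IsAutonomous A ∧ z ∈ A) :
    T.IsAutonomous (⋃₀ 𝒜) := by
  rintro x ⟨A, hA, hx⟩ x' ⟨B, hB, hx'⟩ y hy
  have hyA : y ∉ A := fun h => hy ⟨A, hA, h⟩
  have hyB : y ∉ B := fun h => hy ⟨B, hB, h⟩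
  exact ((h A hA).1 x hx z (h A hA).2 y hyA).trans ((h B hB).1 z (h B hB).2 x' hx' y hyB)

theorem IsAutonomous.notMem_of_cycle {A : Set V} (hA : T.IsAutonomous A)
    (hac : (T.induce A).IsAcyclic) (hx : x ∈ A) (hxy : T.Adj x y) (hyz : T.Adj y z)
    (hzx : T.Adj z x) : y ∉ A ∧ z ∉ A := by
  have hiff : y ∈ A ↔ z ∈ A :=
    ⟨fun hy => by_contra fun hz => hA.not_adj_and_adj hy hx hz ⟨hyz, hzx⟩,
      fun hz => by_contra fun hy => hA.not_adj_and_adj hx hz hy ⟨hxy, hyz⟩⟩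
  have hy : y ∉ A := fun hy =>
    isAcyclic_induce.1 hac x hx y hy z (hiff.1 hy) ⟨hxy, hyz, hzx⟩
  exact ⟨hy, hiff.not.1 hy⟩

theorem isAcyclic_induce_sUnion {𝒜 : Set (Set V)}
    (h : ∀ A ∈ 𝒜, T.IsAutonomous A ∧ (T.induce A).IsAcyclic ∧ z ∈ A) :
    (T.induce (⋃₀ 𝒜)).IsAcyclic := by
  rw [isAcyclic_induce]
  rintro a ⟨A, hA, ha⟩ b ⟨B, hB, hb⟩ c - ⟨hab, hbc, hca⟩
  obtain ⟨hautA, hacA, hzA⟩ := h A hA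
  obtain ⟨hautB, hacB, hzB⟩ := h B hB
  obtain ⟨-, hcA⟩ := hautA.notMem_of_cycle hacA ha hab hbc hca
  obtain ⟨hcB, -⟩ := hautB.notMem_of_cycle hacB hb hbc hca hab
  have hzc : T.Adj z c := (hautB b hb z hzB c hcB).1 hbc
  have hcz : T.Adj c z := (hautA.adj_right_iff ha hzA hcA).1 hca
  exact hcA (T.antisymm _ _ hzc hcz ▸ hzA)

theorem mem_acyclicComponent : y ∈ T.acyclicComponent x ↔
    ∃ A, T.IsAutonomous A ∧ (T.induce A).IsAcyclic ∧ x ∈ A ∧ y ∈ A := by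
  simp only [acyclicComponent, Set.mem_sUnion, Set.mem_ofPred_eq, and_assoc]

theorem isAutonomous_acyclicComponent (T : Tournament V) (x : V) :
    T.IsAutonomous (T.acyclicComponent x) :=
  IsAutonomous.sUnion (z := x) fun _ hA => ⟨hA.1, hA.2.2⟩

theorem isAcyclic_induce_acyclicComponent (T : Tournament V) (x : V) :
    (T.induce (T.acyclicComponent x)).IsAcyclic :=
  isAcyclic_induce_sUnion (z := x) fun _ hA => hA

theorem mem_acyclicComponent_self (T : Tournament V) (x : V) : x ∈ T.acyclicComponent x := by
  refine mem_acyclicComponent.2 ⟨{x}, ?_, ?_, rfl, rfl⟩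
  · rintro _ rfl _ rfl y -
    rfl
  · rw [isAcyclic_induce]
    rintro _ rfl _ rfl _ rfl h
    exact T.irrefl _ h.1

theorem mem_acyclicComponent_iff_eq :
    y ∈ T.acyclicComponent x ↔ T.acyclicComponent y = T.acyclicComponent x := by
  have hsub {x y : V} (h : y ∈ T.acyclicComponent x) :
      T.acyclicComponent x ⊆ T.acyclicComponent y := fun z hz =>
    mem_acyclicComponent.2 ⟨T.acyclicComponent x, T.isAutonomous_acyclicComponent x,
      T.isAcyclic_induce_acyclicComponent x, h, hz⟩
  exact ⟨fun h => (hsub (hsub h (T.mem_acyclicComponent_self x))).antisymm (hsub h),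
    fun h => h ▸ T.mem_acyclicComponent_self y⟩

theorem mem_acyclicComponent_of_embedding {S : Tournament V'} (f : T.Adj ↪r S.Adj)
    (h : f y ∈ S.acyclicComponent (f x)) : y ∈ T.acyclicComponent x := by
  obtain ⟨A, haut, hac, hx, hy⟩ := mem_acyclicComponent.1 h
  refine mem_acyclicComponent.2 ⟨f ⁻¹' A, ?_, ?_, hx, hy⟩
  · intro a ha b hb c hc
    rw [← f.map_rel_iff, ← f.map_rel_iff (a := b)]
    exact haut _ ha _ hb _ hc
  · rw [isAcyclic_induce] at hac ⊢
    intro a ha b hb c hc h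
    exact hac _ ha _ hb _ hc
      ⟨f.map_rel_iff.2 h.1, f.map_rel_iff.2 h.2.1, f.map_rel_iff.2 h.2.2⟩

theorem mem_acyclicComponent_iso {S : Tournament V'} (e : Iso T S) :
    e y ∈ S.acyclicComponent (e x) ↔ y ∈ T.acyclicComponent x :=
  ⟨mem_acyclicComponent_of_embedding e.toRelEmbedding, fun h =>
    mem_acyclicComponent_of_embedding e.symm.toRelEmbedding (by simpa using h)⟩

theorem isAcyclic_induce_coe (A : T.acyclicComponents) : (T.induce (A : Set V)).IsAcyclic := by
  obtain ⟨_, x, rfl⟩ := A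
  exact T.isAcyclic_induce_acyclicComponent x

instance (A : T.acyclicComponents) : Nonempty (A : Set V) := by
  obtain ⟨_, x, rfl⟩ := A
  exact ⟨x, T.mem_acyclicComponent_self x⟩

theorem mem_acyclicComponents_iff_eq {A : T.acyclicComponents} :
    x ∈ (A : Set V) ↔ T.acyclicComponent x = A := by
  obtain ⟨_, y, rfl⟩ := A
  exact mem_acyclicComponent_iff_eq

/-- A tournament is reduced if its acyclic components are singletons. -/
def IsReduced (D : Tournament ι) : Prop :=
  ∀ i j, j ∈ D.acyclicComponent i → j = i

theorem IsReduced.of_iso {D : Tournament ι} {D' : Tournament ι'} (hD : D.IsReduced)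
    (e : Iso D' D) : D'.IsReduced := fun i j h =>
  e.injective (hD (e i) (e j) ((mem_acyclicComponent_iso e).2 h))

end AcyclicComponent

section LexSum

variable {W : ι → Type*} {W' : ι' → Type*} {D : Tournament ι} {S : ∀ i, Tournament (W i)}
  {D' : Tournament ι'} {S' : ∀ i, Tournament (W' i)}

theorem lexSum_adj_of_adj {x y : Σ i, W i} (h : D.Adj x.1 y.1) : (lexSum D S).Adj x y :=
  Sigma.Lex.left _ _ h

theorem lexSum_adj_of_ne {x y : Σ i, W i} (h : x.1 ≠ y.1) :
    (lexSum D S).Adj x y ↔ D.Adj x.1 y.1 :=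
  Sigma.lex_iff.trans (or_iff_left fun ⟨h', _⟩ => h h')

theorem lexSum_adj_mk {i : ι} {x y : W i} : (lexSum D S).Adj ⟨i, x⟩ ⟨i, y⟩ ↔ (S i).Adj x y :=
  Sigma.lex_iff.trans ⟨fun h => h.elim (fun h => absurd h (D.irrefl i)) fun ⟨_, h⟩ => h,
    fun h => Or.inr ⟨rfl, h⟩⟩

theorem fst_ne_of_lexSum_cycle (hS : ∀ i, (S i).IsAcyclic) {x y z : Σ i, W i}
    (hxy : (lexSum D S).Adj x y) (hyz : (lexSum D S).Adj y z) (hzx : (lexSum D S).Adj z x) :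
    x.1 ≠ y.1 := by
  obtain ⟨i, x⟩ := x
  obtain ⟨j, y⟩ := y
  obtain ⟨m, z⟩ := z
  rintro (rfl : i = j)
  by_cases him : i = m
  · subst him
    exact hS i x y z ⟨lexSum_adj_mk.1 hxy, lexSum_adj_mk.1 hyz, lexSum_adj_mk.1 hzx⟩
  · exact him (D.antisymm i m ((lexSum_adj_of_ne him).1 hyz)
      ((lexSum_adj_of_ne (Ne.symm him)).1 hzx))

theorem fst_cycle_of_lexSum_cycle (hS : ∀ i, (S i).IsAcyclic) {x y z : Σ i, W i}
    (hxy : (lexSum D S).Adj x y) (hyz : (lexSum D S).Adj y z) (hzx : (lexSum D S).Adj z x) :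
    D.Adj x.1 y.1 ∧ D.Adj y.1 z.1 ∧ D.Adj z.1 x.1 :=
  ⟨(lexSum_adj_of_ne (fst_ne_of_lexSum_cycle hS hxy hyz hzx)).1 hxy,
    (lexSum_adj_of_ne (fst_ne_of_lexSum_cycle hS hyz hzx hxy)).1 hyz,
    (lexSum_adj_of_ne (fst_ne_of_lexSum_cycle hS hzx hxy hyz)).1 hzx⟩

theorem mem_acyclicComponent_lexSum_of_fst (hS : ∀ i, (S i).IsAcyclic) {x y : Σ i, W i}
    (h : y.1 ∈ D.acyclicComponent x.1) : y ∈ (lexSum D S).acyclicComponent x := by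
  obtain ⟨A, haut, hac, hx, hy⟩ := mem_acyclicComponent.1 h
  rw [isAcyclic_induce] at hac
  refine mem_acyclicComponent.2 ⟨Sigma.fst ⁻¹' A, ?_, isAcyclic_induce.2 ?_, hx, hy⟩
  · intro a ha b hb c hc
    have hne {a : Σ i, W i} (ha : a.1 ∈ A) : a.1 ≠ c.1 := fun h => hc (show c.1 ∈ A from h ▸ ha)
    rw [lexSum_adj_of_ne (hne ha), lexSum_adj_of_ne (hne hb)]
    exact haut _ ha _ hb _ hc
  · rintro a ha b hb c hc ⟨hab, hbc, hca⟩
    exact hac _ ha _ hb _ hc (fst_cycle_of_lexSum_cycle hS hab hbc hca)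

theorem mem_acyclicComponent_lexSum (hS : ∀ i, (S i).IsAcyclic) [∀ i, Nonempty (W i)]
    {x y : Σ i, W i} :
    y ∈ (lexSum D S).acyclicComponent x ↔ y.1 ∈ D.acyclicComponent x.1 := by
  refine ⟨fun h => ?_, mem_acyclicComponent_lexSum_of_fst hS⟩
  obtain ⟨A, haut, hac, hx, hy⟩ := mem_acyclicComponent.1 h
  refine mem_acyclicComponent.2 ⟨Sigma.fst '' A, ?_, ?_, ⟨x, hx, rfl⟩, ⟨y, hy, rfl⟩⟩
  · rintro _ ⟨a, ha, rfl⟩ _ ⟨b, hb, rfl⟩ j hj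
    obtain ⟨z⟩ := ‹∀ i, Nonempty (W i)› j
    have hz : (⟨j, z⟩ : Σ i, W i) ∉ A := fun h => hj ⟨_, h, rfl⟩
    have hab := haut a ha b hb _ hz
    rwa [lexSum_adj_of_ne fun h => hj ⟨a, ha, h⟩,
      lexSum_adj_of_ne fun h => hj ⟨b, hb, h⟩] at hab
  · rw [isAcyclic_induce] at hac ⊢
    rintro _ ⟨a, ha, rfl⟩ _ ⟨b, hb, rfl⟩ _ ⟨c, hc, rfl⟩ ⟨hab, hbc, hca⟩
    exact hac a ha b hb c hc
      ⟨lexSum_adj_of_adj hab, lexSum_adj_of_adj hbc, lexSum_adj_of_adj hca⟩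

theorem finite_acyclicComponents_of_iso_lexSum [Finite ι] {T : Tournament V}
    (hS : ∀ i, (S i).IsAcyclic) (e : Iso T (lexSum D S)) : Finite T.acyclicComponents := by
  refine Finite.of_injective (fun A => (e A.2.choose).1) fun A B hAB => Subtype.ext ?_
  rw [← A.2.choose_spec, ← B.2.choose_spec, ← mem_acyclicComponent_iff_eq,
    ← mem_acyclicComponent_iso e]
  refine mem_acyclicComponent_lexSum_of_fst hS ?_
  rw [show (e A.2.choose).1 = (e B.2.choose).1 from hAB]
  exact D.mem_acyclicComponent_self _

/-- The embedding of lexicographical sums obtained from embeddings of the index tournaments and of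
the summands. -/
def lexSumEmbedding (e : D.Adj ↪r D'.Adj) (f : ∀ i, (S i).Adj ↪r (S' (e i)).Adj) :
    (lexSum D S).Adj ↪r (lexSum D' S').Adj where
  toFun := Sigma.map e fun i => f i
  inj' := e.injective.sigma_map fun i => (f i).injective
  map_rel_iff' {x y} := by
    obtain ⟨i, x⟩ := x
    obtain ⟨j, y⟩ := y
    simp only [Function.Embedding.coeFn_mk, Sigma.map]
    by_cases h : i = j
    · subst h
      rw [lexSum_adj_mk, lexSum_adj_mk, (f i).map_rel_iff]
    · rw [lexSum_adj_of_ne (by simpa using h), lexSum_adj_of_ne (by simpa using e.injective.ne h)]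
      exact e.map_rel_iff

theorem nonempty_iso_lexSum (e : Iso D D') (f : ∀ i, Iso (S i) (S' (e i))) :
    Nonempty (Iso (lexSum D S) (lexSum D' S')) :=
  ⟨RelIso.ofSurjective (lexSumEmbedding e.toRelEmbedding fun i => (f i).toRelEmbedding)
    (e.surjective.sigma_map fun i => (f i).surjective)⟩

theorem exists_iso_index_of_iso_lexSum (hD : D.IsReduced) (hD' : D'.IsReduced)
    (hS : ∀ i, (S i).IsAcyclic) (hS' : ∀ i, (S' i).IsAcyclic) [∀ i, Nonempty (W i)]
    [∀ i, Nonempty (W' i)] (e : Iso (lexSum D S) (lexSum D' S')) :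
    ∃ σ : Iso D D', ∀ i, Nonempty (W i ≃ W' (σ i)) := by
  have hmem {x y : Σ i, W i} : (e y).1 = (e x).1 ↔ y.1 = x.1 := by
    have h := mem_acyclicComponent_iso (x := x) (y := y) e
    rw [mem_acyclicComponent_lexSum hS', mem_acyclicComponent_lexSum hS] at h
    exact ⟨fun h' => hD _ _ (h.1 (h' ▸ D'.mem_acyclicComponent_self _)),
      fun h' => hD' _ _ (h.2 (h' ▸ D.mem_acyclicComponent_self _))⟩
  obtain ⟨σ, hσ⟩ := exists_equiv_fst_eq_of_sigma_equiv e.toEquiv fun _ _ => hmem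
  refine ⟨⟨σ, fun {i j} => ?_⟩, fun i => ?_⟩
  · by_cases hij : i = j
    · exact hij ▸ iff_of_false (D'.irrefl _) (D.irrefl _)
    obtain ⟨x⟩ := ‹∀ i, Nonempty (W i)› i
    obtain ⟨y⟩ := ‹∀ i, Nonempty (W i)› j
    have h := e.map_rel_iff (a := ⟨i, x⟩) (b := ⟨j, y⟩)
    rw [lexSum_adj_of_ne (hmem.not.2 hij), lexSum_adj_of_ne hij] at h
    exact hσ ⟨i, x⟩ ▸ hσ ⟨j, y⟩ ▸ h
  · have h (x : Σ i, W i) : x.1 = i ↔ (e x).1 = σ i := by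
      rw [← σ.apply_eq_iff_eq, ← hσ]
      rfl
    exact ⟨(Equiv.sigmaSubtype i).symm.trans
      ((e.toEquiv.subtypeEquiv h).trans (Equiv.sigmaSubtype (σ i)))⟩

end LexSum

section Skeleton

/-- The tournament induced on a system of representatives of the acyclic components, viewed as a
tournament on the components. The given tournament is the lexicographical sum of its acyclic
components indexed by it. -/
noncomputable def skeleton (T : Tournament V) : Tournament T.acyclicComponents :=
  T.comap (fun A => A.2.choose) fun A B h => Subtype.ext <|
    A.2.choose_spec.symm.trans ((congrArg T.acyclicComponent h).trans B.2.choose_spec)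

theorem skeleton_adj_iff {T : Tournament V} {A B : T.acyclicComponents} (h : A ≠ B) {x y : V}
    (hx : x ∈ (A : Set V)) (hy : y ∈ (B : Set V)) : T.skeleton.Adj A B ↔ T.Adj x y := by
  have haut (C : T.acyclicComponents) : T.IsAutonomous (C : Set V) := by
    rw [← C.2.choose_spec]
    exact T.isAutonomous_acyclicComponent _
  have hrep (C : T.acyclicComponents) : C.2.choose ∈ (C : Set V) :=
    mem_acyclicComponents_iff_eq.2 C.2.choose_spec
  have hdisj {z : V} (hA : z ∈ (A : Set V)) (hB : z ∈ (B : Set V)) : False :=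
    h (Subtype.ext ((mem_acyclicComponents_iff_eq.1 hA).symm.trans
      (mem_acyclicComponents_iff_eq.1 hB)))
  calc T.Adj A.2.choose B.2.choose
      ↔ T.Adj x B.2.choose := haut A _ (hrep A) _ hx _ fun hA => hdisj hA (hrep B)
    _ ↔ T.Adj x y := (haut B).adj_right_iff (hrep B) hy fun hB => hdisj hx hB

/-- A tournament is the lexicographical sum of its acyclic components. -/
def skeletonIso (T : Tournament V) :
    Iso (lexSum T.skeleton fun A => T.induce (A : Set V)) T where
  toFun x := x.2
  invFun x := ⟨⟨T.acyclicComponent x, x, rfl⟩, x, T.mem_acyclicComponent_self x⟩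
  left_inv := by
    rintro ⟨A, x, hx⟩
    obtain rfl : A = ⟨T.acyclicComponent x, x, rfl⟩ :=
      Subtype.ext (mem_acyclicComponents_iff_eq.1 hx).symm
    rfl
  right_inv _ := rfl
  map_rel_iff' {x y} := by
    obtain ⟨A, x⟩ := x
    obtain ⟨B, y⟩ := y
    by_cases h : A = B
    · subst h
      exact (lexSum_adj_mk (S := fun A : T.acyclicComponents => T.induce (A : Set V))).symm
    · rw [lexSum_adj_of_ne h]
      exact (skeleton_adj_iff h x.2 y.2).symm

theorem isReduced_skeleton (T : Tournament V) : T.skeleton.IsReduced := by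
  intro A B h
  obtain ⟨a⟩ : Nonempty (A : Set V) := inferInstance
  obtain ⟨b⟩ : Nonempty (B : Set V) := inferInstance
  have hab : (b : V) ∈ T.acyclicComponent a :=
    (mem_acyclicComponent_iso T.skeletonIso).2 <|
      mem_acyclicComponent_lexSum_of_fst (x := ⟨A, a⟩) (y := ⟨B, b⟩) isAcyclic_induce_coe h
  rw [mem_acyclicComponent_iff_eq, mem_acyclicComponents_iff_eq.1 a.2,
    mem_acyclicComponents_iff_eq.1 b.2] at hab
  exact Subtype.ext hab

end Skeleton

section Blowup

/-- The tournament `D` with each vertex `i` replaced by a chain with `l i + 1` vertices, so that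
every `l : ι → ℕ` gives nonempty chains. -/
def blowup (D : Tournament ι) (l : ι → ℕ) : Tournament (Σ i, Fin (l i + 1)) :=
  lexSum D fun i => chain (l i + 1)

variable {T : Tournament V} {D : Tournament ι} {D' : Tournament ι'} {l : ι → ℕ} {l' : ι' → ℕ}

theorem nonempty_iso_blowup (σ : Iso D D') (hσ : ∀ i, l' (σ i) = l i) :
    Nonempty (Iso (blowup D l) (blowup D' l')) :=
  nonempty_iso_lexSum σ fun i => by rw [hσ i]

theorem nonempty_iso_blowup_iff (hD : D.IsReduced) (hD' : D'.IsReduced) :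
    Nonempty (Iso (blowup D l) (blowup D' l')) ↔ ∃ σ : Iso D D', ∀ i, l' (σ i) = l i := by
  refine ⟨fun ⟨e⟩ => ?_, fun ⟨σ, hσ⟩ => nonempty_iso_blowup σ hσ⟩
  obtain ⟨σ, hσ⟩ := exists_iso_index_of_iso_lexSum hD hD' (fun _ => isAcyclic_chain _)
    (fun _ => isAcyclic_chain _) e
  exact ⟨σ, fun i => (Nat.succ_injective (Fin.equiv_iff_eq.1 (hσ i))).symm⟩

theorem nonempty_embedding_blowup_of_le (D : Tournament ι) {l l' : ι → ℕ} (h : l ≤ l') :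
    Nonempty ((blowup D l).Adj ↪r (blowup D l').Adj) :=
  ⟨lexSumEmbedding (RelEmbedding.refl _) fun i =>
    ⟨Fin.castLEEmb (Nat.succ_le_succ (h i)), Iff.rfl⟩⟩

theorem fst_eq_of_acyclicComponent_eq (hD : D.IsReduced) (f : (blowup D l).Adj ↪r T.Adj)
    {x y : Σ i, Fin (l i + 1)} (h : T.acyclicComponent (f x) = T.acyclicComponent (f y)) :
    x.1 = y.1 :=
  hD _ _ ((mem_acyclicComponent_lexSum fun _ => isAcyclic_chain _).1
    (mem_acyclicComponent_of_embedding f (mem_acyclicComponent_iff_eq.2 h)))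

theorem card_le_card_acyclicComponents [Finite T.acyclicComponents] (hD : D.IsReduced)
    (f : (blowup D l).Adj ↪r T.Adj) : Nat.card ι ≤ Nat.card T.acyclicComponents :=
  Nat.card_le_card_of_injective
    (fun i => (⟨T.acyclicComponent (f ⟨i, 0⟩), _, rfl⟩ : T.acyclicComponents)) fun _ _ h =>
      fst_eq_of_acyclicComponent_eq hD f (Subtype.ext_iff.1 h)

theorem nonempty_embedding_blowup_skeleton {T : Tournament V} {l : T.acyclicComponents → ℕ}
    (hl : ∀ A, (l A + 1 : ℕ) ≤ ENat.card (A : Set V)) :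
    Nonempty ((blowup T.skeleton l).Adj ↪r T.Adj) :=
  ⟨(lexSumEmbedding (S' := fun A : T.acyclicComponents => T.induce (A : Set V))
    (RelEmbedding.refl T.skeleton.Adj) fun A =>
      ((isAcyclic_induce_coe A).nonempty_chain_embedding (hl A)).some).trans
    T.skeletonIso.toRelEmbedding⟩

theorem exists_iso_blowup_skeleton [Finite V] (T : Tournament V) :
    ∃ l, Nonempty (Iso (blowup T.skeleton l) T) := by
  have hcard (A : T.acyclicComponents) : ∃ n : ℕ, ENat.card (A : Set V) = (n + 1 : ℕ) := by
    obtain ⟨n, hn⟩ := Nat.exists_eq_succ_of_ne_zero (Nat.card_pos (α := (A : Set V))).ne'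
    exact ⟨n, by rw [ENat.card_eq_coe_natCard, hn]⟩
  choose l hl using hcard
  obtain ⟨e⟩ := nonempty_iso_lexSum (D' := T.skeleton)
    (S' := fun A : T.acyclicComponents => T.induce (A : Set V)) (RelIso.refl _) fun A =>
      ((isAcyclic_induce_coe A).nonempty_chain_iso (hl A)).some
  exact ⟨l, ⟨e.trans T.skeletonIso⟩⟩

end Blowup

section Shapes

instance {G : Type*} [Group G] [MulAction G ι] : MulAction Gᵈᵐᵃ (Tournament ι) where
  smul c D := D.comap (DomMulAct.mk.symm c • ·) (MulAction.injective _)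
  one_smul D := adj_injective <| funext₂ fun i j =>
    congrArg₂ D.Adj (one_smul G i) (one_smul G j)
  mul_smul c d D := adj_injective <| funext₂ fun _ _ =>
    congrArg₂ D.Adj (mul_smul (DomMulAct.mk.symm d) (DomMulAct.mk.symm c) _)
      (mul_smul (DomMulAct.mk.symm d) (DomMulAct.mk.symm c) _)

/-- The pairs `(D, l)` with `D` reduced for which `T` contains a copy of `blowup D l`. Their orbits
under permutations of `ι` stand for the isomorphism classes of the finite tournaments induced by
`T` that have `|ι|` acyclic components. -/
def shapes (T : Tournament V) (ι : Type*) :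
    SubMulAction (Equiv.Perm ι)ᵈᵐᵃ (Tournament ι × (ι → ℕ)) where
  carrier := {p | p.1.IsReduced ∧ Nonempty ((blowup p.1 p.2).Adj ↪r T.Adj)}
  smul_mem' c p := by
    rintro ⟨hp, ⟨f⟩⟩
    let σ : Iso (c • p.1) p.1 := p.1.comapIso (DomMulAct.mk.symm c)
    obtain ⟨e⟩ := nonempty_iso_blowup (l := (c • p).2) (l' := p.2) σ fun _ => rfl
    exact ⟨hp.of_iso σ, ⟨e.toRelEmbedding.trans f⟩⟩

variable {T : Tournament V}

theorem mem_orbit_iff_nonempty_iso_blowup {D D' : Tournament ι} {l l' : ι → ℕ}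
    (hD : D.IsReduced) (hD' : D'.IsReduced) :
    (D, l) ∈ MulAction.orbit (Equiv.Perm ι)ᵈᵐᵃ (D', l') ↔
      Nonempty (Iso (blowup D l) (blowup D' l')) := by
  rw [nonempty_iso_blowup_iff hD hD']
  constructor
  · rintro ⟨c, hc⟩
    obtain ⟨rfl, rfl⟩ := Prod.ext_iff.1 hc
    exact ⟨D'.comapIso (DomMulAct.mk.symm c), fun _ => rfl⟩
  · rintro ⟨σ, hσ⟩
    exact ⟨DomMulAct.mk σ.toEquiv, Prod.ext
      (adj_injective (funext₂ fun _ _ => propext σ.map_rel_iff)) (funext hσ)⟩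

theorem isLowerSet_shapes (T : Tournament V) (D : Tournament ι) :
    IsLowerSet (Prod.mk D ⁻¹' (T.shapes ι : Set (Tournament ι × (ι → ℕ)))) :=
  fun _ _ hle ⟨hD, ⟨f⟩⟩ =>
    ⟨hD, (nonempty_embedding_blowup_of_le D hle).map fun g => g.trans f⟩

theorem card_le_ncard_infinite_acyclicComponents [Finite T.acyclicComponents] {D : Tournament ι}
    {A : Finset ι}
    (hA : IsUnboundedAlong (Prod.mk D ⁻¹' (T.shapes ι : Set (Tournament ι × (ι → ℕ)))) A) :
    #A ≤ {C ∈ T.acyclicComponents | C.Infinite}.ncard := by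
  let F : Set V := ⋃₀ {C ∈ T.acyclicComponents | ¬ C.Infinite}
  have hF : F.Finite := Set.Finite.sUnion ((Set.toFinite T.acyclicComponents).sep _)
    fun C hC => Set.not_infinite.1 hC.2
  obtain ⟨l, ⟨hD, ⟨f⟩⟩, hl⟩ := hA F.ncard
  have hexit : ∀ i ∈ A, ∃ j, f ⟨i, j⟩ ∉ F := by
    intro i hi
    by_contra! h
    have hle : (Set.range (f ∘ Sigma.mk i)).ncard ≤ F.ncard :=
      Set.ncard_le_ncard (Set.range_subset_iff.2 h) hF
    rw [Set.ncard_range_of_injective (f.injective.comp sigma_mk_injective), Nat.card_fin] at hle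
    exact absurd (hl i hi) (Nat.not_le.2 hle)
  choose! j hj using hexit
  rw [← Set.ncard_coe_finset]
  refine Set.ncard_le_ncard_of_injOn (fun i => T.acyclicComponent (f ⟨i, j i⟩)) ?_ ?_
    ((Set.toFinite T.acyclicComponents).sep _)
  · intro i hi
    refine ⟨⟨_, rfl⟩, by_contra fun hfin => hj i hi ?_⟩
    exact ⟨_, ⟨⟨_, rfl⟩, hfin⟩, T.mem_acyclicComponent_self _⟩
  · exact fun i _ i' _ h => fst_eq_of_acyclicComponent_eq hD f h

theorem isUnboundedAlong_shapes (c : ι ≃ T.acyclicComponents) {A : Finset ι}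
    (hA : ∀ i ∈ A, (c i : Set V).Infinite) :
    IsUnboundedAlong (Prod.mk (T.skeleton.comap c c.injective) ⁻¹'
      (T.shapes ι : Set (Tournament ι × (ι → ℕ)))) A := by
  classical
  intro N
  refine ⟨fun i => if i ∈ A then N else 0, ⟨T.isReduced_skeleton.of_iso (comapIso _ c), ?_⟩,
    fun i hi => (if_pos hi).ge⟩
  obtain ⟨e⟩ := nonempty_iso_blowup (l := fun i => if i ∈ A then N else 0)
    (l' := fun B => if c.symm B ∈ A then N else 0) (T.skeleton.comapIso c)
    fun i => by
      change (if c.symm (c i) ∈ A then N else 0) = _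
      rw [c.symm_apply_apply]
  refine (nonempty_embedding_blowup_skeleton fun B => ?_).map e.toRelEmbedding.trans
  split_ifs with hB
  · have hinf : (B : Set V).Infinite := by simpa using hA _ hB
    have := hinf.to_subtype
    exact le_top.trans_eq ENat.card_eq_top_of_infinite.symm
  · exact (ENat.one_le_card_iff_nonempty _).2 inferInstance

end Shapes

section Profile

variable {T : Tournament V} {r n : ℕ}

theorem exists_finset_iso_blowup (p : configurations (T.shapes (Fin r)) n) :
    ∃ A : {A : Finset V // #A = n},
      Nonempty (Iso (blowup p.1.1 p.1.2) (T.induce (A.1 : Set V))) := by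
  obtain ⟨⟨D, l⟩, ⟨-, ⟨f⟩⟩, hn⟩ := p
  obtain ⟨A, hA, hiso⟩ := exists_finset_iso_of_embedding f
  exact ⟨⟨A, hA.trans (by simpa using hn)⟩, hiso⟩

/-- The isomorphism class of a tournament induced by `T` that has the given shape. -/
noncomputable def classOfShape (T : Tournament V) (r n : ℕ) :
    MulAction.orbitRel.Quotient (Equiv.Perm (Fin r))ᵈᵐᵃ (configurations (T.shapes (Fin r)) n) →
      Quotient (T.isoSetoid n) :=
  Quotient.lift (fun p => Quotient.mk _ (exists_finset_iso_blowup p).choose) fun p q hpq => by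
    obtain ⟨e⟩ := (mem_orbit_iff_nonempty_iso_blowup p.2.1.1 q.2.1.1).1
      (SubMulAction.mem_orbit_subMul_iff.1 hpq)
    obtain ⟨fp⟩ := (exists_finset_iso_blowup p).choose_spec
    obtain ⟨fq⟩ := (exists_finset_iso_blowup q).choose_spec
    exact Quotient.sound ⟨fp.symm.trans (e.trans fq)⟩

theorem classOfShape_mk_eq_mk_iff {p : configurations (T.shapes (Fin r)) n}
    {A : {A : Finset V // #A = n}} :
    T.classOfShape r n (Quotient.mk _ p) = Quotient.mk _ A ↔
      Nonempty (Iso (blowup p.1.1 p.1.2) (T.induce (A.1 : Set V))) := by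
  obtain ⟨e⟩ := (exists_finset_iso_blowup p).choose_spec
  exact Quotient.eq.trans ⟨fun ⟨f⟩ => ⟨e.trans f⟩, fun ⟨f⟩ => ⟨e.symm.trans f⟩⟩

theorem injective_classOfShape (T : Tournament V) (m n : ℕ) :
    Function.Injective fun x : Σ r : Fin m, MulAction.orbitRel.Quotient (Equiv.Perm (Fin r))ᵈᵐᵃ
      (configurations (T.shapes (Fin r)) n) => T.classOfShape x.1 n x.2 := by
  rintro ⟨⟨r, hr⟩, ⟨p⟩⟩ ⟨⟨s, hs⟩, ⟨q⟩⟩ h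
  obtain ⟨A, ⟨fq⟩⟩ := exists_finset_iso_blowup q
  obtain ⟨fp⟩ := classOfShape_mk_eq_mk_iff.1 (h.trans (classOfShape_mk_eq_mk_iff.2 ⟨fq⟩))
  have e : Iso (blowup p.1.1 p.1.2) (blowup q.1.1 q.1.2) := fp.trans fq.symm
  obtain ⟨σ, -⟩ := (nonempty_iso_blowup_iff p.2.1.1 q.2.1.1).1 ⟨e⟩
  obtain rfl : r = s := Fin.equiv_iff_eq.1 ⟨σ.toEquiv⟩
  refine Sigma.ext rfl (heq_of_eq (Quotient.sound ?_))
  exact SubMulAction.mem_orbit_subMul_iff.2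
    ((mem_orbit_iff_nonempty_iso_blowup p.2.1.1 q.2.1.1).2 ⟨e⟩)

theorem exists_classOfShape_eq [Finite T.acyclicComponents] (x : Quotient (T.isoSetoid n)) :
    ∃ r < Nat.card T.acyclicComponents + 1, ∃ y, T.classOfShape r n y = x := by
  obtain ⟨A, hA⟩ := x
  let S := T.induce (A : Set V)
  obtain ⟨l, ⟨e⟩⟩ := S.exists_iso_blowup_skeleton
  have f := e.toRelEmbedding.trans (T.induceEmbedding A)
  have : Finite S.acyclicComponents := Set.toFinite _
  let c := (Finite.equivFin S.acyclicComponents).symm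
  obtain ⟨e'⟩ := nonempty_iso_blowup (l := l ∘ c) (l' := l) (S.skeleton.comapIso c) fun _ => rfl
  have hn : ∑ i, 1 * ((l ∘ c) i + 1) = n := by
    have hcard := Nat.card_congr (e'.trans e).toEquiv
    rw [Nat.card_sigma] at hcard
    simpa [hA] using hcard
  refine ⟨_, Nat.lt_succ_of_le (card_le_card_acyclicComponents S.isReduced_skeleton f),
    Quotient.mk _ ⟨(S.skeleton.comap c c.injective, l ∘ c), ⟨?_, ?_⟩, hn⟩,
    classOfShape_mk_eq_mk_iff.2 ⟨e'.trans e⟩⟩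
  · exact S.isReduced_skeleton.of_iso (comapIso _ c)
  · exact ⟨e'.toRelEmbedding.trans f⟩

theorem profile_eq_sum_card_orbits (T : Tournament V) [Finite T.acyclicComponents] (n : ℕ) :
    T.profile n = ∑ r : Fin (Nat.card T.acyclicComponents + 1), Nat.card
      (MulAction.orbitRel.Quotient (Equiv.Perm (Fin r))ᵈᵐᵃ
        (configurations (T.shapes (Fin r)) n)) := by
  have (r : ℕ) := finite_configurations (T.shapes (Fin r)) n
  rw [← Nat.card_sigma]
  refine (Nat.card_eq_of_bijective _ ⟨injective_classOfShape T _ n, fun x => ?_⟩).symm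
  obtain ⟨r, hr, y, hy⟩ := exists_classOfShape_eq x
  exact ⟨⟨⟨r, hr⟩, y⟩, hy⟩

theorem profileSeries_mem_fractionSeries (T : Tournament V) [Finite T.acyclicComponents] :
    T.profileSeries ∈
      fractionSeries (qPochhammer ℤ {A ∈ T.acyclicComponents | A.Infinite}.ncard) := by
  have hsum : T.profileSeries =
      ∑ r : Fin (Nat.card T.acyclicComponents + 1), orbitSeries (T.shapes (Fin r)) := by
    ext n
    simp [profileSeries, orbitSeries, profile_eq_sum_card_orbits]
  rw [hsum]
  exact sum_mem fun r _ => orbitSeries_mem_fractionSeries (fun D => T.isLowerSet_shapes D)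
    fun D A => card_le_ncard_infinite_acyclicComponents

theorem pow_isBigO_profile (T : Tournament V) [Finite T.acyclicComponents] {k : ℕ}
    (hk : {A ∈ T.acyclicComponents | A.Infinite}.ncard = k + 1) :
    (fun n : ℕ => (n : ℝ) ^ k) =O[atTop] fun n => (T.profile n : ℝ) := by
  classical
  obtain ⟨c⟩ : Nonempty (Fin (Nat.card T.acyclicComponents) ≃ T.acyclicComponents) :=
    ⟨(Finite.equivFin _).symm⟩
  let A : Finset (Fin (Nat.card T.acyclicComponents)) := {i | (c i : Set V).Infinite}
  have hA : #A = k + 1 := by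
    have himage : {C ∈ T.acyclicComponents | C.Infinite} = (fun i => (c i : Set V)) '' A := by
      ext C
      constructor
      · rintro ⟨hC, hinf⟩
        obtain ⟨i, hi⟩ := c.surjective ⟨C, hC⟩
        obtain rfl : (c i : Set V) = C := congrArg Subtype.val hi
        exact ⟨i, mem_filter.2 ⟨mem_univ i, hinf⟩, rfl⟩
      · rintro ⟨i, hi, rfl⟩
        exact ⟨(c i).2, (mem_filter.1 hi).2⟩
    have hinj : Function.Injective fun i => (c i : Set V) := Subtype.val_injective.comp c.injective
    rw [← hk, himage, Set.ncard_image_of_injective _ hinj, Set.ncard_coe_finset]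
  refine (pow_isBigO_card_orbits (isLowerSet_shapes T _)
    (isUnboundedAlong_shapes c fun i hi => (mem_filter.1 hi).2) hA).trans ?_
  refine isBigO_of_le _ fun n => ?_
  rw [Real.norm_of_nonneg (by positivity), Real.norm_of_nonneg (by positivity),
    profile_eq_sum_card_orbits]
  exact_mod_cast single_le_sum_of_canonicallyOrdered
    (f := fun r : Fin (Nat.card T.acyclicComponents + 1) => Nat.card
      (MulAction.orbitRel.Quotient (Equiv.Perm (Fin r))ᵈᵐᵃ (configurations (T.shapes (Fin r)) n)))
    (mem_univ (Fin.last _))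

end Profile

end Tournament

theorem theorem6 {V I : Type*} {W : I → Type*} [Finite I]
    (T : Tournament V) (D : Tournament I) (S : ∀ i, Tournament (W i))
    (hS : ∀ i, (S i).IsAcyclic)
    (hT : Nonempty (Tournament.Iso T (Tournament.lexSum D S))) :
    ∃ k : ℕ, {A ∈ T.acyclicComponents | A.Infinite}.encard = k ∧
      (∃ P : Polynomial ℤ,
        T.profileSeries * ∏ i ∈ Finset.Icc 1 k, (1 - PowerSeries.X ^ i) =
          (P : PowerSeries ℤ)) ∧
      ∃ a : ℝ, 0 ≤ a ∧ (1 ≤ k → 0 < a) ∧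
        Asymptotics.IsEquivalent Filter.atTop (fun n : ℕ => (T.profile n : ℝ))
          (fun n : ℕ => a * (n : ℝ) ^ ((k : ℤ) - 1)) := by
  obtain ⟨e⟩ := hT
  have := Tournament.finite_acyclicComponents_of_iso_lexSum hS e
  have hfin : {A ∈ T.acyclicComponents | A.Infinite}.Finite :=
    (Set.toFinite T.acyclicComponents).sep _
  have hseries := T.profileSeries_mem_fractionSeries
  obtain ⟨P, hP⟩ := mem_fractionSeries.1 hseries
  refine ⟨{A ∈ T.acyclicComponents | A.Infinite}.ncard, hfin.cast_ncard_eq.symm, ⟨P, ?_⟩,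
    exists_isEquivalent_mul_zpow hseries fun hk => T.pow_isBigO_profile ?_⟩
  · rw [hP, coe_qPochhammer, mul_comm]
  · exact (Nat.sub_add_cancel hk).symm
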